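/- Let $\phi$ be the standard normal density, let $G$ be the standard Cauchy distribution, with density $\gamma(u)=\frac{1}{\pi(1+u^2)}$, and let $g(x)=\int\phi(x-u)\,dG(u)$. For $\theta_0\in\mathbb{R}^n$, let $P_{\theta_0}$, with expectation $E_{\theta_0}$, be the law of $X=(X_1,\dots,X_n)$ with $X_i=\theta_{0,i}+\varepsilon_i$ and $\varepsilon_1,\dots,\varepsilon_n$ i.i.d. $\mathcal N(0,1)$. For $\alpha\in[0,1]$, the posterior distribution of $\theta\in\mathbb{R}^n$ given $X$ under the spike-and-slab prior $\bigotimes_{i=1}^n\big((1-\alpha)\delta_0+\alpha G\big)$ is $$\Pi_\alpha[\cdot\,|\,X]=\bigotimes_{i=1}^n\big((1-a_\alpha(X_i))\,\delta_0+a_\alpha(X_i)\,G_{X_i}\big),\qquad a_\alpha(x)=\frac{\alpha g(x)}{(1-\alpha)\phi(x)+\alpha g(x)},$$ where $G_x$ has Lebesgue density $u\mapsto\phi(x-u)\gamma(u)/g(x)$. For $\alpha\in(0,1]$, let $t(\alpha)\ge 0$ be the number such that the median of $(1-a_\alpha(x))\delta_0+a_\alpha(x)G_x$ is $0$ if and only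 if $|x|\le t(\alpha)$, and let $\alpha_n\in(0,1]$ be the solution of $t(\alpha_n)=\sqrt{2\log n}$. Let $\hat\alpha=\hat\alpha(X)$ be a maximiser over $\alpha\in[\alpha_n,1]$ of the log-marginal likelihood $$\ell_n(\alpha;X)=\sum_{i=1}^n\log\big((1-\alpha)\phi(X_i)+\alpha g(X_i)\big),$$ and let $\Pi_{\hat\alpha}[\cdot\,|\,X]$ be the plug-in posterior, i.e. $\Pi_\alpha[\cdot\,|\,X]$ at $\alpha=\hat\alpha(X)$. For $s\ge 0$ let $\ell_0[s]=\{\theta\in\mathbb{R}^n:\#\{i:\theta_i\ne0\}\le s\}$ and $r_n=2s_n\log(n/s_n)$ (with $r_n=0$ if $s_n=0$), and let $\|\cdot\|$ be the Euclidean norm. There exist constants $C,c_0,c_1>0$ and $N_0>0$ such that, for every $n\ge N_0$: 1. for every $s_n$ with $c_1\log^2 n\le s_n\le c_0n$, $$\sup_{\theta_0\in\ell_0[s_n]}E_{\theta_0}\int\|\theta-\theta_0\|^2\,d\Pi_{\hat\alpha}(\theta\,|\,X)\le C\,r_n;$$ 2. for every $s_n$ with $0\le s_n\le c_0n$, $$\sup_{\theta_0\in\ell_0[s_n]}E_{\theta_0}\int\|\theta-\theta_0\|^2\,d\Pi_{\hat\alpha}(\theta\,|\,X)\le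 C\,r_n+C\log^3n.$$ -/

import Mathlib

open MeasureTheory ProbabilityTheory

namespace SpikeSlab

noncomputable section

/-- The standard normal density `φ`. -/
def phi (x : ℝ) : ℝ := gaussianPDFReal 0 1 x

/-- The slab distribution `G`: the standard Cauchy distribution. -/
def slab : Measure ℝ := cauchyMeasure 0 1

/-- The Lebesgue density `γ` of the slab. -/
def slabDensity (u : ℝ) : ℝ := cauchyPDFReal 0 1 u

/-- The convolution `g = φ * G`. -/
def g (x : ℝ) : ℝ := ∫ u, phi (x - u) ∂slab

/-- The law `P_θ` of `X = θ + ε`, with `ε` a vector of `n` independent standard normal variables. -/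
def dataLaw {n : ℕ} (θ : Fin n → ℝ) : Measure (Fin n → ℝ) :=
  Measure.pi fun i => gaussianReal (θ i) 1

/-- The class `ℓ₀[s]` of vectors of `ℝⁿ` with at most `s` nonzero coordinates. -/
def sparseVectors (n : ℕ) (s : ℝ) : Set (Fin n → ℝ) :=
  {θ | ((Set.ncard {i | θ i ≠ 0} : ℕ) : ℝ) ≤ s}

/-- The posterior weight `a_α(x)` of the slab, given the observation `x` of a coordinate. -/
def postWeight (α x : ℝ) : ℝ := α * g x / ((1 - α) * phi x + α * g x)

/-- The distribution `G_x`, with Lebesgue density `u ↦ φ(x - u) γ(u) / g(x)`. -/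
def slabPosterior (x : ℝ) : Measure ℝ :=
  volume.withDensity fun u => ENNReal.ofReal (phi (x - u) * slabDensity u / g x)

/-- The posterior distribution `(1 - a_α(x)) δ₀ + a_α(x) G_x` of a single coordinate under the prior
`(1 - α) δ₀ + α G`, given the observation `x` of this coordinate. -/
def coordPosterior (α x : ℝ) : Measure ℝ :=
  ENNReal.ofReal (1 - postWeight α x) • Measure.dirac 0 +
    ENNReal.ofReal (postWeight α x) • slabPosterior x

/-- The posterior distribution `Π_α[· | X]` of the whole vector. -/
def posterior {n : ℕ} (α : ℝ) (X : Fin n → ℝ) : Measure (Fin n → ℝ) :=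
  Measure.pi fun i => coordPosterior α (X i)

/-- `m` is a median of the probability distribution `μ`. -/
def IsMedian (μ : Measure ℝ) (m : ℝ) : Prop :=
  1 / 2 ≤ μ (Set.Iic m) ∧ 1 / 2 ≤ μ (Set.Ici m)

/-- The threshold `t(α)` of the posterior median: the number such that the posterior median of
a coordinate vanishes exactly when its observation `x` satisfies `|x| ≤ t(α)`. -/
def medianThreshold (α : ℝ) : ℝ :=
  Classical.epsilon fun t : ℝ => ∀ x : ℝ, IsMedian (coordPosterior α x) 0 ↔ |x| ≤ t

/-- The weight `α_n` in `(0, 1]` that solves `t(α_n) = √(2 log n)`. -/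
def alphaMin (n : ℕ) : ℝ :=
  Function.invFunOn medianThreshold (Set.Ioc 0 1) (Real.sqrt (2 * Real.log n))

/-- The log-marginal likelihood `ℓ_n(α; X)`. -/
def logMarginal {n : ℕ} (α : ℝ) (X : Fin n → ℝ) : ℝ :=
  ∑ i, Real.log ((1 - α) * phi (X i) + α * g (X i))

/-- `αhat` is a marginal maximum likelihood estimator: for all data `X`, the value `αhat X`
maximises `ℓ_n(·; X)` over the interval `[α_n, 1]`. -/
def IsMarginalMLE {n : ℕ} (αhat : (Fin n → ℝ) → ℝ) : Prop :=
  ∀ X, αhat X ∈ Set.Icc (alphaMin n) 1 ∧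
    IsMaxOn (fun α => logMarginal α X) (Set.Icc (alphaMin n) 1) (αhat X)

/-- The risk `E_{θ₀} ∫ ‖θ - θ₀‖² dΠ_{αhat}(θ | X)` of the plug-in posterior, in `[0, ∞]`. -/
def postRisk {n : ℕ} (αhat : (Fin n → ℝ) → ℝ) (θ₀ : Fin n → ℝ) : ENNReal :=
  ∫⁻ X, ∫⁻ θ, ENNReal.ofReal (∑ i, (θ i - θ₀ i) ^ 2) ∂posterior (αhat X) X ∂dataLaw θ₀

/-- The rate `r_n = 2 s log (n / s)`, which is `0` for `s = 0`. -/
def rate (n : ℕ) (s : ℝ) : ℝ := 2 * s * Real.log (n / s)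

end

end SpikeSlab

/-!
The log-likelihood is concave in `α`, so the sign of its derivative, the score, at a given `α`
locates the estimator `αhat` relative to `α`.

* Upper bound. At a null coordinate the exponential moment of `α / 2` times the score is less than
  `1`, so by Chernoff's bound `αhat` is at most a multiple of `(s / n) √(log (n / s))` off an event
  of small probability. The null coordinates then contribute `O(s log (n / s))` to the risk.
* Lower bound. If `k` means satisfy `θ_i² > 16 log (1024 n / k)`, then `αhat ≥ k / (32 n)` unless
  half of them have an exceptionally large noise, an event of probability at most `exp (-k / 4)` on
  which the deterministic bound `αhat ≥ α_n ≥ 1 / (7 n)` suffices. A posterior with weight `α`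
  estimates a mean at quadratic cost `O(log (1 / α))`, uniformly in the mean.

For the largest such `k`, up to `k` coordinates pay `log (n / k)` each, and the squares of the
remaining nonzero means sum to at most `∑_{j > k} 16 log (1024 n / j)`; both are `O(s log (n / s))`.
-/

namespace SpikeSlab

/-! ### Elementary inequalities -/

lemma one_add_sq_le_mul (x v : ℝ) : 1 + x ^ 2 ≤ 2 * (1 + v ^ 2) * (1 + (x - v) ^ 2) := by
  nlinarith [sq_nonneg (x - 2 * v), sq_nonneg (v * (x - v))]

lemma one_add_sq_le_exp {c : ℝ} (hc : 1 ≤ c) (x : ℝ) : 1 + x ^ 2 ≤ c * Real.exp (x ^ 2 / c) := by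
  have h := Real.add_one_le_exp (x ^ 2 / c)
  have : c * (x ^ 2 / c + 1) = x ^ 2 + c := by field_simp
  nlinarith

lemma mul_exp_neg_div_le {c : ℝ} (hc : 0 < c) (x : ℝ) : x * Real.exp (-(x / c)) ≤ c := by
  have h := Real.add_one_le_exp (x / c)
  have hx : x = c * (x / c) := by field_simp
  rw [Real.exp_neg, ← div_eq_mul_inv, div_le_iff₀ (Real.exp_pos _)]
  nlinarith

lemma mul_log_div_le {a s : ℝ} (ha : 0 < a) (hs : 0 < s) : a * Real.log (s / a) ≤ s := by
  have h : Real.log (s / a) ≤ s / a := Real.log_le_self (div_pos hs ha).le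
  calc a * Real.log (s / a) ≤ a * (s / a) := by gcongr
    _ = s := by field_simp

lemma sum_log_div_le {s : ℝ} (hs : 0 < s) (m : ℕ) :
    ∑ j ∈ Finset.Icc 1 m, Real.log (s / j) ≤ s := by
  have hne : ∀ j ∈ Finset.Icc 1 m, s / (j : ℝ) ≠ 0 := fun j hj => by
    have : 1 ≤ j := (Finset.mem_Icc.1 hj).1
    positivity
  rw [← Real.log_prod hne, Finset.prod_div_distrib, Finset.prod_const, Nat.card_Icc,
    Nat.add_sub_cancel, ← Nat.cast_prod, ← Finset.Ico_add_one_right_eq_Icc,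
    Finset.prod_Ico_id_eq_factorial, Real.log_le_iff_le_exp (by positivity)]
  exact Real.pow_div_factorial_le_exp _ hs.le m

/-! ### Splitting a finite family at a self-consistent level -/

section Levels

variable {ι M : Type*} [AddCommMonoid M] [LinearOrder M] [IsOrderedAddMonoid M]

lemma exists_subset_sum_sdiff_le [DecidableEq ι] (f : ι → M) (t : ℕ → M) {k m : ℕ}
    (hkm : k ≤ m) (I : Finset ι) (hI : I.card = m)
    (hlt : ∀ j, k < j → j ≤ m → {i ∈ I | t j < f i}.card < j) :
    ∃ L ⊆ I, L.card ≤ k ∧ ∑ i ∈ I \ L, f i ≤ ∑ j ∈ Finset.Ioc k m, t j := by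
  induction m, hkm using Nat.le_induction generalizing I with
  | base => exact ⟨I, subset_rfl, hI.le, by simp⟩
  | succ m hkm ih =>
    obtain ⟨i, hi, hfi⟩ : ∃ i ∈ I, f i ≤ t (m + 1) := by
      by_contra! hlarge
      have := hlt (m + 1) (by lia) le_rfl
      rw [Finset.filter_true_of_mem hlarge, hI] at this
      exact this.false
    obtain ⟨L, hL, hLk, hsum⟩ := ih (I.erase i) (by rw [Finset.card_erase_of_mem hi, hI]; rfl)
      fun j hj hjm => lt_of_le_of_lt
        (Finset.card_le_card (Finset.filter_subset_filter _ (Finset.erase_subset i I)))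
        (hlt j hj (by lia))
    refine ⟨L, hL.trans (Finset.erase_subset i I), hLk, ?_⟩
    have hiL : i ∉ L := fun hiL => Finset.notMem_erase i I (hL hiL)
    have hins : I \ L = insert i (I.erase i \ L) := by
      rw [← Finset.insert_sdiff_of_notMem _ hiL, Finset.insert_erase hi]
    rw [hins, Finset.sum_insert (by simp), Finset.sum_Ioc_succ_top hkm, add_comm]
    exact add_le_add hsum hfi

lemma exists_large_subset [DecidableEq ι] (f : ι → M) (t : ℕ → M) (I : Finset ι) :
    ∃ K ⊆ I, (∀ i ∈ K, t K.card < f i) ∧ ∃ L ⊆ I, L.card ≤ K.card ∧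
      ∑ i ∈ I \ L, f i ≤ ∑ j ∈ Finset.Ioc K.card I.card, t j := by
  classical
  let P : ℕ → Prop := fun k => k ≤ {i ∈ I | t k < f i}.card
  have hP : P (Nat.findGreatest P I.card) :=
    Nat.findGreatest_spec (P := P) (Nat.zero_le _) (Nat.zero_le _)
  obtain ⟨K, hK, hcard⟩ := Finset.exists_subset_card_eq hP
  refine ⟨K, hK.trans (Finset.filter_subset _ _), fun i hi => ?_, ?_⟩
  · rw [hcard]
    exact (Finset.mem_filter.1 (hK hi)).2
  · rw [hcard]
    exact exists_subset_sum_sdiff_le f t (Nat.findGreatest_le _) I rfl fun j hj hjm =>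
      not_le.1 (Nat.findGreatest_is_greatest (P := P) hj hjm)

end Levels

/-! ### Upper integrals and the Chernoff bound -/

section UpperIntegral

variable {Ω : Type*} [MeasurableSpace Ω] {μ : Measure Ω} {f f' : Ω → ℝ} {c c' : ℝ}

/-- The upper integral of `f` is at most `c`: some integrable majorant of `f` has integral at most
`c`. No measurability of `f` is required, since the estimator `αhat` is an arbitrary maximiser;
unlike `∫⁻`, this notion is subadditive without measurability. -/
def UpperIntegralLE (μ : Measure Ω) (f : Ω → ℝ) (c : ℝ) : Prop :=
  ∃ F : Ω → ℝ, Integrable F μ ∧ (∀ ω, f ω ≤ F ω) ∧ ∫ ω, F ω ∂μ ≤ c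

lemma UpperIntegralLE.of_integrable (hf : Integrable f μ) (h : ∫ ω, f ω ∂μ ≤ c) :
    UpperIntegralLE μ f c :=
  ⟨f, hf, fun _ => le_rfl, h⟩

lemma UpperIntegralLE.mono (h : UpperIntegralLE μ f c) (hf : ∀ ω, f' ω ≤ f ω) (hc : c ≤ c') :
    UpperIntegralLE μ f' c' :=
  let ⟨F, hF, hle, hint⟩ := h
  ⟨F, hF, fun ω => (hf ω).trans (hle ω), hint.trans hc⟩

lemma UpperIntegralLE.add (h : UpperIntegralLE μ f c) (h' : UpperIntegralLE μ f' c') :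
    UpperIntegralLE μ (fun ω => f ω + f' ω) (c + c') := by
  obtain ⟨F, hF, hle, hint⟩ := h
  obtain ⟨F', hF', hle', hint'⟩ := h'
  refine ⟨fun ω => F ω + F' ω, hF.add hF', fun ω => add_le_add (hle ω) (hle' ω), ?_⟩
  rw [integral_add hF hF']
  exact add_le_add hint hint'

lemma UpperIntegralLE.const_mul {a : ℝ} (ha : 0 ≤ a) (h : UpperIntegralLE μ f c) :
    UpperIntegralLE μ (fun ω => a * f ω) (a * c) := by
  obtain ⟨F, hF, hle, hint⟩ := h
  refine ⟨fun ω => a * F ω, hF.const_mul a, fun ω => mul_le_mul_of_nonneg_left (hle ω) ha, ?_⟩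
  rw [integral_const_mul]
  exact mul_le_mul_of_nonneg_left hint ha

lemma UpperIntegralLE.sum {ι : Type*} {f : ι → Ω → ℝ} {c : ι → ℝ} {s : Finset ι}
    (h : ∀ i ∈ s, UpperIntegralLE μ (f i) (c i)) :
    UpperIntegralLE μ (fun ω => ∑ i ∈ s, f i ω) (∑ i ∈ s, c i) := by
  classical
  induction s using Finset.induction_on with
  | empty => exact .of_integrable (by simp) (by simp)
  | insert i s hi ih =>
    simp only [Finset.sum_insert hi]
    exact (h i (Finset.mem_insert_self i s)).add
      (ih fun j hj => h j (Finset.mem_insert_of_mem hj))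

lemma UpperIntegralLE.lintegral_le (h : UpperIntegralLE μ f c) (hf : ∀ ω, 0 ≤ f ω) :
    ∫⁻ ω, ENNReal.ofReal (f ω) ∂μ ≤ ENNReal.ofReal c := by
  obtain ⟨F, hF, hle, hint⟩ := h
  calc ∫⁻ ω, ENNReal.ofReal (f ω) ∂μ ≤ ∫⁻ ω, ENNReal.ofReal (F ω) ∂μ :=
        lintegral_mono fun ω => ENNReal.ofReal_le_ofReal (hle ω)
    _ = ENNReal.ofReal (∫ ω, F ω ∂μ) :=
        (ofReal_integral_eq_lintegral_ofReal hF
          (.of_forall fun ω => (hf ω).trans (hle ω))).symm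
    _ ≤ ENNReal.ofReal c := ENNReal.ofReal_le_ofReal hint

lemma upperIntegralLE_const [IsProbabilityMeasure μ] (c : ℝ) : UpperIntegralLE μ (fun _ => c) c :=
  .of_integrable (integrable_const c) (by simp)

lemma upperIntegralLE_indicator [IsFiniteMeasure μ] {s : Set Ω} (hs : MeasurableSet s) {a : ℝ}
    (h : μ.real s * a ≤ c) : UpperIntegralLE μ (s.indicator fun _ => a) c :=
  .of_integrable ((integrable_const a).indicator hs) (by
    rwa [integral_indicator_const a hs, smul_eq_mul])

end UpperIntegral

section Product

variable {ι : Type*} [Fintype ι] {Ω : ι → Type*} [∀ i, MeasurableSpace (Ω i)]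
  {μ : ∀ i, Measure (Ω i)} [∀ i, IsProbabilityMeasure (μ i)]

lemma upperIntegralLE_pi_eval {i : ι} {f : Ω i → ℝ} {c : ℝ} (hf : Integrable f (μ i))
    (h : ∫ x, f x ∂μ i ≤ c) : UpperIntegralLE (Measure.pi μ) (fun X => f (X i)) c :=
  .of_integrable (integrable_comp_eval hf) (by rwa [integral_comp_eval hf.aestronglyMeasurable])

lemma measureReal_pi_le_exp_sum_sub {h : ∀ i, Ω i → ℝ} (hm : ∀ i, Measurable (h i)) {t : ℝ}
    (ht : 0 ≤ t) {s : Finset ι} (hint : ∀ i ∈ s, Integrable (fun x => Real.exp (t * h i x)) (μ i))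
    {b : ι → ℝ} (hb : ∀ i ∈ s, mgf (h i) (μ i) t ≤ Real.exp (b i)) (ε : ℝ) :
    (Measure.pi μ).real {X | ε ≤ ∑ i ∈ s, h i (X i)} ≤ Real.exp (∑ i ∈ s, b i - t * ε) := by
  have hind : iIndepFun (fun i (X : ∀ i, Ω i) => h i (X i)) (Measure.pi μ) :=
    iIndepFun_pi fun i => (hm i).aemeasurable
  have hm' : ∀ i, Measurable fun X : ∀ i, Ω i => h i (X i) :=
    fun i => (hm i).comp (measurable_pi_apply i)
  have hmgf : ∀ i ∈ s, mgf (fun X : ∀ i, Ω i => h i (X i)) (Measure.pi μ) t = mgf (h i) (μ i) t :=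
    fun i hi => integral_comp_eval (hint i hi).aestronglyMeasurable
  have hchernoff := measure_ge_le_exp_mul_mgf ε ht (hind.integrable_exp_mul_sum hm'
    fun i hi => integrable_comp_eval (hint i hi))
  rw [hind.mgf_sum hm', Finset.prod_congr rfl hmgf] at hchernoff
  calc (Measure.pi μ).real {X | ε ≤ ∑ i ∈ s, h i (X i)}
      ≤ Real.exp (-t * ε) * ∏ i ∈ s, mgf (h i) (μ i) t := by
        simpa only [Finset.sum_apply] using hchernoff
    _ ≤ Real.exp (-t * ε) * ∏ i ∈ s, Real.exp (b i) := by
        gcongr with i hi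
        exacts [fun i _ => mgf_nonneg, hb i hi]
    _ = Real.exp (∑ i ∈ s, b i - t * ε) := by
        rw [← Real.exp_sum, ← Real.exp_add, neg_mul, neg_add_eq_sub]

end Product

/-! ### The normal and the Cauchy densities -/

lemma phi_eq (x : ℝ) : phi x = (√(2 * Real.pi))⁻¹ * Real.exp (-x ^ 2 / 2) := by
  simp [phi, gaussianPDFReal]

lemma slabDensity_eq (u : ℝ) : slabDensity u = Real.pi⁻¹ * (1 + u ^ 2)⁻¹ := by
  simp [slabDensity, cauchyPDFReal_def']

lemma phi_pos (x : ℝ) : 0 < phi x := gaussianPDFReal_pos _ _ _ one_ne_zero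

lemma slabDensity_pos (u : ℝ) : 0 < slabDensity u := cauchyPDF_pos _ one_ne_zero _

@[fun_prop]
lemma continuous_slabDensity : Continuous slabDensity := by
  rw [funext slabDensity_eq]
  exact continuous_const.mul ((by fun_prop : Continuous fun x : ℝ => 1 + x ^ 2).inv₀
    fun x => by positivity)

@[fun_prop]
lemma measurable_phi : Measurable phi := measurable_gaussianPDFReal 0 1

@[fun_prop]
lemma measurable_slabDensity : Measurable slabDensity := continuous_slabDensity.measurable

lemma integrable_phi : Integrable phi := integrable_gaussianPDFReal 0 1

lemma integral_phi : ∫ x, phi x = 1 := integral_gaussianPDFReal_eq_one 0 one_ne_zero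

lemma integrable_slabDensity : Integrable slabDensity := integrable_cauchyPDFReal 0

lemma integral_slabDensity : ∫ x, slabDensity x = 1 := integral_cauchyPDFReal_eq_one 0 one_ne_zero

lemma phi_neg (x : ℝ) : phi (-x) = phi x := by simp [phi_eq]

lemma slabDensity_neg (x : ℝ) : slabDensity (-x) = slabDensity x := by simp [slabDensity_eq]

lemma phi_sub (x u : ℝ) : phi (x - u) = phi x * Real.exp (x * u - u ^ 2 / 2) := by
  rw [phi_eq, phi_eq, mul_assoc, ← Real.exp_add]
  congr 2
  ring

lemma phi_le (x : ℝ) : phi x ≤ Real.exp (-x ^ 2 / 2) / 2 := by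
  have h : 2 ≤ √(2 * Real.pi) := Real.le_sqrt_of_sq_le (by nlinarith [Real.pi_gt_three])
  rw [phi_eq, div_eq_inv_mul (Real.exp _)]
  gcongr

lemma le_phi (x : ℝ) : Real.exp (-x ^ 2 / 2) / 3 ≤ phi x := by
  have h : √(2 * Real.pi) ≤ 3 :=
    Real.sqrt_le_iff.2 ⟨by norm_num, by nlinarith [Real.pi_lt_d2]⟩
  rw [phi_eq, div_eq_inv_mul (Real.exp _)]
  gcongr

lemma phi_le_one (x : ℝ) : phi x ≤ 1 := by
  have h : Real.exp (-x ^ 2 / 2) ≤ 1 := Real.exp_le_one_iff.2 (by nlinarith [sq_nonneg x])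
  linarith [phi_le x]

lemma slabDensity_le_mul (x u : ℝ) :
    slabDensity u ≤ 2 / (Real.pi * (1 + x ^ 2)) * (1 + (u - x) ^ 2) := by
  have h := one_add_sq_le_mul x (x - u)
  rw [sub_sub_cancel, sub_sq_comm] at h
  rw [slabDensity_eq, ← mul_inv, inv_le_iff_one_le_mul₀ (by positivity)]
  field_simp
  linarith

/-! ### Moments of the normal distribution -/

lemma gaussianPDFReal_eq_phi_sub (m x : ℝ) : gaussianPDFReal m 1 x = phi (m - x) := by
  rw [phi_eq, sub_sq_comm]
  simp [gaussianPDFReal]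

lemma integrable_gaussianReal_iff {m : ℝ} {f : ℝ → ℝ} :
    Integrable f (gaussianReal m 1) ↔ Integrable fun x => phi (m - x) * f x := by
  rw [gaussianReal_of_var_ne_zero m one_ne_zero, integrable_withDensity_iff_integrable_smul'
    (measurable_gaussianPDF _ _) (.of_forall fun _ => gaussianPDF_lt_top)]
  simp only [toReal_gaussianPDF, gaussianPDFReal_eq_phi_sub, smul_eq_mul]

lemma integral_gaussianReal_eq (m : ℝ) (f : ℝ → ℝ) :
    ∫ x, f x ∂gaussianReal m 1 = ∫ x, phi (m - x) * f x := by
  simp only [integral_gaussianReal_eq_integral_smul one_ne_zero, gaussianPDFReal_eq_phi_sub,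
    smul_eq_mul]

lemma integrable_sub_pow_gaussianReal (m c : ℝ) (k : ℕ) :
    Integrable (fun x => (x - c) ^ k) (gaussianReal m 1) := by
  have h : MemLp (fun x => x - c) k (gaussianReal m 1) :=
    (memLp_id_gaussianReal k).sub (memLp_const c)
  rw [← integrable_norm_iff (by fun_prop)]
  simpa only [norm_pow] using h.integrable_norm_pow'

lemma integrable_pow_gaussianReal (m : ℝ) (k : ℕ) :
    Integrable (fun x => x ^ k) (gaussianReal m 1) := by
  simpa using integrable_sub_pow_gaussianReal m 0 k

lemma integral_sub_sq_gaussianReal (m : ℝ) : ∫ x, (x - m) ^ 2 ∂gaussianReal m 1 = 1 := by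
  have h := variance_fun_id_gaussianReal (μ := m) (v := 1)
  rwa [variance_eq_integral (by fun_prop), integral_id_gaussianReal] at h

lemma integral_one_add_sq_gaussianReal (m : ℝ) :
    ∫ x, (1 + x ^ 2) ∂gaussianReal m 1 = 2 + m ^ 2 := by
  have hvar := variance_eq_sub (memLp_id_gaussianReal (μ := m) (v := 1) 2)
  simp only [variance_id_gaussianReal, Pi.pow_apply, id_eq, integral_id_gaussianReal,
    NNReal.coe_one] at hvar
  rw [integral_add (integrable_const 1) (integrable_pow_gaussianReal m 2)]
  simp only [integral_const, probReal_univ, smul_eq_mul]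
  linarith

lemma hasDerivAt_phi (x : ℝ) : HasDerivAt phi (-(phi x * x)) x := by
  rw [funext phi_eq]
  have h : HasDerivAt (fun y : ℝ => -y ^ 2 / 2) (-x) x :=
    ((hasDerivAt_pow 2 x).neg.div_const 2).congr_deriv (by norm_num; ring)
  exact (h.exp.const_mul _).congr_deriv (by ring)

lemma integral_sub_pow_four_gaussianReal (m : ℝ) :
    ∫ x, (x - m) ^ 4 ∂gaussianReal m 1 = 3 := by
  have hint : ∀ k : ℕ, Integrable fun x => phi x * x ^ k := fun k => by
    simpa [phi_neg] using integrable_gaussianReal_iff.1 (integrable_pow_gaussianReal 0 k)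
  have hparts : ∫ x, x ^ 3 * -(phi x * x) = -∫ x, 3 * x ^ 2 * phi x := by
    refine integral_mul_deriv_eq_deriv_mul_of_integrable (fun x _ => ?_)
      (fun x _ => hasDerivAt_phi x) ?_ ?_ ?_
    · simpa using hasDerivAt_pow 3 x
    · exact (hint 4).neg.congr (.of_forall fun x => by simp only [Pi.neg_apply, Pi.mul_apply]; ring)
    · exact ((hint 2).const_mul 3).congr (.of_forall fun x => by simp only [Pi.mul_apply]; ring)
    · exact (hint 3).congr (.of_forall fun x => by simp only [Pi.mul_apply]; ring)
  have hsq : ∫ x, phi x * x ^ 2 = 1 := by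
    simpa [integral_gaussianReal_eq, phi_neg] using integral_sub_sq_gaussianReal 0
  calc ∫ x, (x - m) ^ 4 ∂gaussianReal m 1 = ∫ x, phi (x - m) * (x - m) ^ 4 := by
        simp_rw [integral_gaussianReal_eq, ← phi_neg (_ - m), neg_sub]
    _ = ∫ x, phi x * x ^ 4 := integral_sub_right_eq_self (fun x => phi x * x ^ 4) m
    _ = -∫ x, x ^ 3 * -(phi x * x) := by
        rw [← integral_neg]
        exact integral_congr_ae (.of_forall fun x => by ring)
    _ = 3 * ∫ x, phi x * x ^ 2 := by
        rw [hparts, neg_neg, ← integral_const_mul]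
        exact integral_congr_ae (.of_forall fun x => by ring)
    _ = 3 := by rw [hsq, mul_one]

/-! ### The marginal density of the slab -/

lemma integrable_phi_sub_mul_slabDensity (x : ℝ) :
    Integrable fun u => phi (x - u) * slabDensity u := by
  refine integrable_slabDensity.mono' (by fun_prop) (.of_forall fun u => ?_)
  rw [Real.norm_of_nonneg (mul_nonneg (phi_pos _).le (slabDensity_pos _).le)]
  exact mul_le_of_le_one_left (slabDensity_pos _).le (phi_le_one _)

lemma g_eq (x : ℝ) : g x = ∫ u, phi (x - u) * slabDensity u := by
  have hslab : slab = volume.withDensity fun u => ENNReal.ofReal (slabDensity u) := by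
    rw [slab, cauchyMeasure_of_scale_ne_zero 0 one_ne_zero]
    rfl
  rw [g, hslab, integral_withDensity_eq_integral_toReal_smul (by fun_prop) (by simp)]
  refine integral_congr_ae (.of_forall fun u => ?_)
  simp [ENNReal.toReal_ofReal (slabDensity_pos u).le, mul_comm]

lemma g_eq_integral_gaussianReal (x : ℝ) : g x = ∫ u, slabDensity u ∂gaussianReal x 1 := by
  rw [g_eq, integral_gaussianReal_eq]

lemma integrable_slabDensity_gaussianReal (x : ℝ) : Integrable slabDensity (gaussianReal x 1) :=
  integrable_gaussianReal_iff.2 (integrable_phi_sub_mul_slabDensity x)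

lemma g_le (x : ℝ) : g x ≤ 4 / (Real.pi * (1 + x ^ 2)) := by
  have hint := integrable_sub_pow_gaussianReal x x 2
  calc g x ≤ ∫ u, 2 / (Real.pi * (1 + x ^ 2)) * (1 + (u - x) ^ 2) ∂gaussianReal x 1 := by
        rw [g_eq_integral_gaussianReal]
        exact integral_mono (integrable_slabDensity_gaussianReal x)
          (((integrable_const 1).add hint).const_mul _) (slabDensity_le_mul x)
    _ = 4 / (Real.pi * (1 + x ^ 2)) := by
        rw [integral_const_mul, integral_add (integrable_const 1) hint,
          integral_sub_sq_gaussianReal]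
        simp only [integral_const, probReal_univ, smul_eq_mul]
        ring

-- Jensen's inequality for the convex function `y ↦ 1 / y`.
lemma le_g (x : ℝ) : (Real.pi * (2 + x ^ 2))⁻¹ ≤ g x := by
  have hconv : ConvexOn ℝ (Set.Ici 1) fun y : ℝ => y⁻¹ := by
    simpa only [zpow_neg_one] using (convexOn_zpow (𝕜 := ℝ) (-1)).subset
      (Set.Ici_subset_Ioi.2 one_pos) (convex_Ici 1)
  have hcont : ContinuousOn (fun y : ℝ => y⁻¹) (Set.Ici 1) :=
    continuousOn_inv₀.mono fun y hy => (one_pos.trans_le hy).ne'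
  have hγ : ∀ u, (1 + u ^ 2)⁻¹ = Real.pi * slabDensity u := fun u => by
    rw [slabDensity_eq, mul_inv_cancel_left₀ Real.pi_ne_zero]
  have hjensen := hconv.map_integral_le (μ := gaussianReal x 1) (f := fun u => 1 + u ^ 2) hcont
    isClosed_Ici (.of_forall fun u => by simp [sq_nonneg])
    ((integrable_const 1).add (integrable_pow_gaussianReal x 2)) (by
      simpa only [Function.comp_def, hγ] using
        (integrable_slabDensity_gaussianReal x).const_mul Real.pi)
  simp only [hγ, integral_one_add_sq_gaussianReal, integral_const_mul,
    ← g_eq_integral_gaussianReal] at hjensen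
  rwa [mul_inv, inv_mul_le_iff₀ Real.pi_pos]

lemma g_pos (x : ℝ) : 0 < g x := lt_of_lt_of_le (by positivity) (le_g x)

@[fun_prop]
lemma measurable_g : Measurable g := by
  rw [funext g_eq]
  exact (StronglyMeasurable.integral_prod_right (f := fun x u => phi (x - u) * slabDensity u)
    (by unfold Function.uncurry; fun_prop : Measurable _).stronglyMeasurable).measurable

lemma integrable_phi_sub_mul_slabDensity_prod :
    Integrable (fun p : ℝ × ℝ => phi (p.1 - p.2) * slabDensity p.2) (volume.prod volume) := by
  simpa [mul_comm] using integrable_slabDensity.convolution_integrand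
    (ContinuousLinearMap.mul ℝ ℝ) integrable_phi

lemma integrable_g : Integrable g := by
  rw [funext g_eq]
  exact integrable_phi_sub_mul_slabDensity_prod.integral_prod_left

lemma integral_g : ∫ x, g x = 1 := by
  simp_rw [g_eq]
  rw [integral_integral_swap integrable_phi_sub_mul_slabDensity_prod]
  simp_rw [integral_mul_const, integral_sub_right_eq_self phi, integral_phi, one_mul]
  exact integral_slabDensity

lemma exp_mul_phi_le (x : ℝ) : Real.exp (x ^ 2 / 4) * phi x ≤ 32 * g x := by
  have hexp : Real.exp (x ^ 2 / 4) * (Real.exp (-x ^ 2 / 2) / 2)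
      = (2 * Real.exp (x ^ 2 / 4))⁻¹ := by
    rw [mul_inv, ← Real.exp_neg, mul_div_assoc', ← Real.exp_add, div_eq_inv_mul]
    ring_nf
  have hpoly : Real.pi * (2 + x ^ 2) ≤ 32 * (2 * Real.exp (x ^ 2 / 4)) := by
    have h := one_add_sq_le_exp (c := 4) (by norm_num) x
    nlinarith [Real.pi_lt_four, Real.pi_pos, sq_nonneg x]
  calc Real.exp (x ^ 2 / 4) * phi x ≤ Real.exp (x ^ 2 / 4) * (Real.exp (-x ^ 2 / 2) / 2) := by
        gcongr
        exact phi_le x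
    _ = 32 * (32 * (2 * Real.exp (x ^ 2 / 4)))⁻¹ := by rw [hexp, mul_inv 32]; ring
    _ ≤ 32 * (Real.pi * (2 + x ^ 2))⁻¹ := by gcongr
    _ ≤ 32 * g x := by
        gcongr
        exact le_g x

lemma g_le_exp_mul_phi (x : ℝ) : g x ≤ 6 * Real.exp (x ^ 2 / 2) * phi x := by
  have hexp : Real.exp (x ^ 2 / 2) * Real.exp (-x ^ 2 / 2) = 1 := by
    rw [← Real.exp_add, ← Real.exp_zero]
    ring_nf
  have htwo : 4 / (Real.pi * (1 + x ^ 2)) ≤ 2 := by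
    rw [div_le_iff₀ (by positivity)]
    nlinarith [Real.pi_gt_three, sq_nonneg x]
  calc g x ≤ 2 := (g_le x).trans htwo
    _ = 6 * Real.exp (x ^ 2 / 2) * (Real.exp (-x ^ 2 / 2) / 3) := by linear_combination -2 * hexp
    _ ≤ 6 * Real.exp (x ^ 2 / 2) * phi x := by
        gcongr
        exact le_phi x

/-! ### The posterior of one coordinate -/

section Posterior

variable {α : ℝ}

lemma mixture_pos (h0 : 0 ≤ α) (h1 : α ≤ 1) (x : ℝ) : 0 < (1 - α) * phi x + α * g x := by
  rcases h0.eq_or_lt with rfl | h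
  · simpa using phi_pos x
  · exact add_pos_of_nonneg_of_pos (mul_nonneg (by linarith) (phi_pos x).le) (mul_pos h (g_pos x))

lemma postWeight_nonneg (h0 : 0 ≤ α) (h1 : α ≤ 1) (x : ℝ) : 0 ≤ postWeight α x :=
  div_nonneg (mul_nonneg h0 (g_pos x).le) (mixture_pos h0 h1 x).le

lemma one_sub_postWeight (h0 : 0 ≤ α) (h1 : α ≤ 1) (x : ℝ) :
    1 - postWeight α x = (1 - α) * phi x / ((1 - α) * phi x + α * g x) := by
  have := mixture_pos h0 h1 x
  rw [postWeight, eq_div_iff this.ne', sub_mul, div_mul_cancel₀ _ this.ne']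
  ring

lemma one_sub_postWeight_nonneg (h0 : 0 ≤ α) (h1 : α ≤ 1) (x : ℝ) : 0 ≤ 1 - postWeight α x := by
  rw [one_sub_postWeight h0 h1]
  exact div_nonneg (mul_nonneg (by linarith) (phi_pos x).le) (mixture_pos h0 h1 x).le

lemma postWeight_le_one (h0 : 0 ≤ α) (h1 : α ≤ 1) (x : ℝ) : postWeight α x ≤ 1 :=
  sub_nonneg.1 (one_sub_postWeight_nonneg h0 h1 x)

lemma postWeight_mono {β : ℝ} (h0 : 0 ≤ α) (h : α ≤ β) (h1 : β ≤ 1) (x : ℝ) :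
    postWeight α x ≤ postWeight β x := by
  have hφg := mul_pos (phi_pos x) (g_pos x)
  rw [postWeight, postWeight, div_le_div_iff₀ (mixture_pos h0 (h.trans h1) x)
    (mixture_pos (h0.trans h) h1 x)]
  nlinarith [mul_le_mul_of_nonneg_right h hφg.le]

@[fun_prop]
lemma measurable_postWeight (α : ℝ) : Measurable (postWeight α) := by
  unfold postWeight
  fun_prop

lemma slabPosterior_apply (x : ℝ) {s : Set ℝ} (hs : MeasurableSet s) :
    slabPosterior x s = ENNReal.ofReal ((∫ u in s, phi (x - u) * slabDensity u) / g x) := by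
  rw [slabPosterior, withDensity_apply _ hs, ← integral_div,
    ofReal_integral_eq_lintegral_ofReal]
  · exact ((integrable_phi_sub_mul_slabDensity x).div_const _).integrableOn
  · exact .of_forall fun u =>
      div_nonneg (mul_nonneg (phi_pos _).le (slabDensity_pos _).le) (g_pos x).le

instance isProbabilityMeasure_slabPosterior (x : ℝ) : IsProbabilityMeasure (slabPosterior x) := by
  constructor
  rw [slabPosterior_apply x .univ, setIntegral_univ, ← g_eq, div_self (g_pos x).ne',
    ENNReal.ofReal_one]

lemma isProbabilityMeasure_coordPosterior (h0 : 0 ≤ α) (h1 : α ≤ 1) (x : ℝ) :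
    IsProbabilityMeasure (coordPosterior α x) := by
  constructor
  simp only [coordPosterior, Measure.add_apply, Measure.smul_apply, measure_univ, smul_eq_mul,
    mul_one]
  rw [← ENNReal.ofReal_add (one_sub_postWeight_nonneg h0 h1 x) (postWeight_nonneg h0 h1 x),
    sub_add_cancel, ENNReal.ofReal_one]

lemma coordPosterior_apply_of_zero_mem (h0 : 0 ≤ α) (h1 : α ≤ 1) (x : ℝ) {s : Set ℝ}
    (hs : MeasurableSet s) (h0s : 0 ∈ s) :
    coordPosterior α x s = ENNReal.ofReal
      (((1 - α) * phi x + α * ∫ u in s, phi (x - u) * slabDensity u) /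
        ((1 - α) * phi x + α * g x)) := by
  have hg := g_pos x
  have hD := mixture_pos h0 h1 x
  have hint : 0 ≤ ∫ u in s, phi (x - u) * slabDensity u :=
    integral_nonneg fun u => mul_nonneg (phi_pos _).le (slabDensity_pos u).le
  simp only [coordPosterior, Measure.add_apply, Measure.smul_apply, smul_eq_mul,
    Measure.dirac_apply' _ hs, slabPosterior_apply x hs, Set.indicator_of_mem h0s,
    Pi.one_apply, mul_one]
  rw [← ENNReal.ofReal_mul (postWeight_nonneg h0 h1 x),
    ← ENNReal.ofReal_add (one_sub_postWeight_nonneg h0 h1 x)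
      (mul_nonneg (postWeight_nonneg h0 h1 x) (by positivity)),
    one_sub_postWeight h0 h1, postWeight]
  congr 1
  field_simp

lemma half_le_coordPosterior_iff (h0 : 0 ≤ α) (h1 : α ≤ 1) (x : ℝ) {s : Set ℝ}
    (hs : MeasurableSet s) (h0s : 0 ∈ s) :
    1 / 2 ≤ coordPosterior α x s ↔
      α * (g x - 2 * ∫ u in s, phi (x - u) * slabDensity u) ≤ (1 - α) * phi x := by
  have hhalf : (1 / 2 : ENNReal) = ENNReal.ofReal (1 / 2) := by
    rw [ENNReal.ofReal_div_of_pos two_pos]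
    simp
  have hint : 0 ≤ ∫ u in s, phi (x - u) * slabDensity u :=
    integral_nonneg fun u => mul_nonneg (phi_pos _).le (slabDensity_pos u).le
  have hφ : 0 ≤ (1 - α) * phi x := mul_nonneg (by linarith) (phi_pos x).le
  have hD := mixture_pos h0 h1 x
  rw [coordPosterior_apply_of_zero_mem h0 h1 x hs h0s, hhalf,
    ENNReal.ofReal_le_ofReal_iff (by positivity), le_div_iff₀ hD]
  constructor <;> intro h <;> linarith

end Posterior

/-! ### The threshold of the posterior median -/

/-- The part `∫_{u > 0} exp (x u - u² / 2) γ(u) du` of the likelihood ratio `g / φ` that is due to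
positive parameters. -/
noncomputable def posRatio (x : ℝ) : ℝ :=
  ∫ u in Set.Ioi 0, Real.exp (x * u - u ^ 2 / 2) * slabDensity u

/-- The excess of the positive over the negative part of the likelihood ratio `g / φ`. It is odd
and increasing, and the posterior median at `x` vanishes iff `α * ratioGap |x| ≤ 1 - α`. -/
noncomputable def ratioGap (x : ℝ) : ℝ := posRatio x - posRatio (-x)

lemma integrable_exp_mul_slabDensity (x : ℝ) :
    Integrable fun u => Real.exp (x * u - u ^ 2 / 2) * slabDensity u := by
  refine ((integrable_phi_sub_mul_slabDensity x).const_mul (phi x)⁻¹).congr (.of_forall fun u => ?_)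
  simp only [phi_sub, mul_assoc, inv_mul_cancel_left₀ (phi_pos x).ne']

lemma setIntegral_Ioi_phi_sub_mul_slabDensity (x : ℝ) :
    ∫ u in Set.Ioi 0, phi (x - u) * slabDensity u = phi x * posRatio x := by
  rw [posRatio, ← integral_const_mul]
  simp_rw [phi_sub, mul_assoc]

lemma setIntegral_Iic_phi_sub_mul_slabDensity (x : ℝ) :
    ∫ u in Set.Iic 0, phi (x - u) * slabDensity u = phi x * posRatio (-x) := by
  rw [← phi_neg x, ← setIntegral_Ioi_phi_sub_mul_slabDensity, ← neg_zero,
    ← integral_comp_neg_Iic, neg_zero]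
  refine setIntegral_congr_fun measurableSet_Iic fun u _ => ?_
  simp only [slabDensity_neg, ← phi_neg (x - u), neg_sub, sub_neg_eq_add, neg_add_eq_sub]

lemma g_eq_phi_mul_posRatio (x : ℝ) : g x = phi x * (posRatio x + posRatio (-x)) := by
  rw [g_eq, ← integral_add_compl measurableSet_Ioi (integrable_phi_sub_mul_slabDensity x),
    Set.compl_Ioi, setIntegral_Ioi_phi_sub_mul_slabDensity, setIntegral_Iic_phi_sub_mul_slabDensity,
    mul_add]

lemma posRatio_nonneg (x : ℝ) : 0 ≤ posRatio x :=
  integral_nonneg fun _ => mul_nonneg (Real.exp_nonneg _) (slabDensity_pos _).le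

lemma strictMono_posRatio : StrictMono posRatio := by
  intro x y h
  have hint : ∀ x, IntegrableOn (fun u => Real.exp (x * u - u ^ 2 / 2) * slabDensity u)
      (Set.Ioi 0) := fun x => (integrable_exp_mul_slabDensity x).integrableOn
  have hlt : ∀ u ∈ Set.Ioi (0 : ℝ), 0 < Real.exp (y * u - u ^ 2 / 2) * slabDensity u
      - Real.exp (x * u - u ^ 2 / 2) * slabDensity u := fun u hu =>
    sub_pos.2 (mul_lt_mul_of_pos_right
      (Real.exp_lt_exp.2 (sub_lt_sub_right (mul_lt_mul_of_pos_right h hu) _)) (slabDensity_pos u))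
  rw [← sub_pos, posRatio, posRatio, ← integral_sub (hint y) (hint x),
    setIntegral_pos_iff_support_of_nonneg_ae
      ((ae_restrict_iff' measurableSet_Ioi).2 (.of_forall fun u hu => (hlt u hu).le))
      ((hint y).sub (hint x))]
  calc (0 : ENNReal) < volume (Set.Ioi (0 : ℝ)) := by simp
    _ ≤ _ := measure_mono (Set.subset_inter (fun u hu => (hlt u hu).ne') subset_rfl)

lemma continuous_posRatio : Continuous posRatio := by
  refine continuous_iff_continuousAt.2 fun x => ?_
  refine continuousAt_of_dominated (bound := fun u => Real.exp ((x + 1) * u - u ^ 2 / 2) *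
    slabDensity u) (.of_forall fun y => (by fun_prop)) ?_
    (integrable_exp_mul_slabDensity _).integrableOn (.of_forall fun u => (by fun_prop))
  filter_upwards [Iio_mem_nhds (lt_add_one x)] with y hy
  refine (ae_restrict_iff' measurableSet_Ioi).2 (.of_forall fun u hu => ?_)
  rw [Real.norm_of_nonneg (mul_nonneg (Real.exp_nonneg _) (slabDensity_pos _).le)]
  have : y * u ≤ (x + 1) * u := mul_le_mul_of_nonneg_right (le_of_lt hy) (le_of_lt hu)
  exact mul_le_mul_of_nonneg_right (Real.exp_le_exp.2 (by linarith)) (slabDensity_pos u).le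

lemma posRatio_le_one {x : ℝ} (hx : x ≤ 0) : posRatio x ≤ 1 := by
  calc posRatio x ≤ ∫ u in Set.Ioi 0, slabDensity u := by
        refine setIntegral_mono_on (integrable_exp_mul_slabDensity x).integrableOn
          integrable_slabDensity.integrableOn measurableSet_Ioi fun u hu => ?_
        refine mul_le_of_le_one_left (slabDensity_pos u).le (Real.exp_le_one_iff.2 ?_)
        have : x * u ≤ 0 := mul_nonpos_of_nonpos_of_nonneg hx (le_of_lt hu)
        nlinarith [sq_nonneg u]
    _ ≤ ∫ u, slabDensity u :=
        setIntegral_le_integral integrable_slabDensity (.of_forall fun u => (slabDensity_pos u).le)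
    _ = 1 := integral_slabDensity

lemma strictMono_ratioGap : StrictMono ratioGap := fun _ _ h =>
  sub_lt_sub (strictMono_posRatio h) (strictMono_posRatio (neg_lt_neg h))

lemma continuous_ratioGap : Continuous ratioGap :=
  continuous_posRatio.sub (continuous_posRatio.comp continuous_neg)

lemma ratioGap_neg (x : ℝ) : ratioGap (-x) = -ratioGap x := by simp [ratioGap]

lemma ratioGap_zero : ratioGap 0 = 0 := by simp [ratioGap]

lemma ratioGap_nonneg {x : ℝ} (hx : 0 ≤ x) : 0 ≤ ratioGap x :=
  ratioGap_zero ▸ strictMono_ratioGap.monotone hx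

lemma ratioGap_abs (x : ℝ) : ratioGap |x| = |ratioGap x| := by
  rcases le_total 0 x with h | h
  · rw [abs_of_nonneg h, abs_of_nonneg (ratioGap_nonneg h)]
  · rw [abs_of_nonpos h, ← abs_neg, ← ratioGap_neg,
      abs_of_nonneg (ratioGap_nonneg (neg_nonneg.2 h))]

lemma ratioGap_le_g_div_phi (x : ℝ) : ratioGap x ≤ g x / phi x := by
  rw [g_eq_phi_mul_posRatio, mul_div_cancel_left₀ _ (phi_pos x).ne', ratioGap]
  linarith [posRatio_nonneg (-x)]

lemma g_div_phi_sub_two_le_ratioGap {x : ℝ} (hx : 0 ≤ x) : g x / phi x - 2 ≤ ratioGap x := by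
  rw [g_eq_phi_mul_posRatio, mul_div_cancel_left₀ _ (phi_pos x).ne', ratioGap]
  linarith [posRatio_le_one (neg_nonpos.2 hx)]

lemma exists_ratioGap_eq {y : ℝ} (hy : 0 ≤ y) : ∃ t, 0 ≤ t ∧ ratioGap t = y := by
  have hx : y ≤ ratioGap √(128 * (y + 2)) := by
    refine le_trans ?_ (g_div_phi_sub_two_le_ratioGap (Real.sqrt_nonneg _))
    have hexp := Real.add_one_le_exp (√(128 * (y + 2)) ^ 2 / 4)
    have hratio : Real.exp (√(128 * (y + 2)) ^ 2 / 4) / 32 ≤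
        g √(128 * (y + 2)) / phi √(128 * (y + 2)) := by
      rw [le_div_iff₀ (phi_pos _)]
      linarith [exp_mul_phi_le √(128 * (y + 2))]
    rw [Real.sq_sqrt (by positivity)] at hexp hratio
    linarith
  obtain ⟨t, ht, h⟩ := intermediate_value_Icc (Real.sqrt_nonneg _)
    continuous_ratioGap.continuousOn ⟨ratioGap_zero.le.trans hy, hx⟩
  exact ⟨t, ht.1, h⟩

lemma isMedian_zero_iff {α : ℝ} (h0 : 0 ≤ α) (h1 : α ≤ 1) (x : ℝ) :
    IsMedian (coordPosterior α x) 0 ↔ α * ratioGap |x| ≤ 1 - α := by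
  have hIic : g x - 2 * (phi x * posRatio (-x)) = ratioGap x * phi x := by
    rw [g_eq_phi_mul_posRatio, ratioGap]
    ring
  have hIci : g x - 2 * (phi x * posRatio x) = -ratioGap x * phi x := by
    rw [g_eq_phi_mul_posRatio, ratioGap]
    ring
  rw [IsMedian, half_le_coordPosterior_iff h0 h1 x measurableSet_Iic (by simp),
    half_le_coordPosterior_iff h0 h1 x measurableSet_Ici (by simp), integral_Ici_eq_integral_Ioi,
    setIntegral_Iic_phi_sub_mul_slabDensity, setIntegral_Ioi_phi_sub_mul_slabDensity, hIic, hIci,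
    ← mul_assoc, ← mul_assoc, mul_le_mul_iff_left₀ (phi_pos x), mul_le_mul_iff_left₀ (phi_pos x),
    mul_neg, ← max_le_iff, ← abs_eq_max_neg, abs_mul, abs_of_nonneg h0, ratioGap_abs]

lemma medianThreshold_eq {α t : ℝ} (h0 : 0 < α) (h1 : α ≤ 1) (ht : 0 ≤ t)
    (h : ratioGap t = (1 - α) / α) : medianThreshold α = t := by
  have hspec : ∀ x : ℝ, IsMedian (coordPosterior α x) 0 ↔ |x| ≤ t := fun x => by
    rw [isMedian_zero_iff h0.le h1, ← strictMono_ratioGap.le_iff_le (b := t), h, le_div_iff₀ h0,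
      mul_comm]
  have heps : ∀ x : ℝ, |x| ≤ medianThreshold α ↔ |x| ≤ t := fun x =>
    (Classical.epsilon_spec (p := fun t : ℝ => ∀ x : ℝ,
      IsMedian (coordPosterior α x) 0 ↔ |x| ≤ t) ⟨t, hspec⟩ x).symm.trans (hspec x)
  have hle : t ≤ medianThreshold α := by simpa [abs_of_nonneg ht] using heps t
  have hge : medianThreshold α ≤ t := by
    simpa [abs_of_nonneg (ht.trans hle)] using heps (medianThreshold α)
  exact hge.antisymm hle

lemma alphaMin_eq (n : ℕ) : alphaMin n = (1 + ratioGap √(2 * Real.log n))⁻¹ := by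
  set T := √(2 * Real.log n)
  have hT0 : 0 ≤ T := Real.sqrt_nonneg _
  have hgap := ratioGap_nonneg hT0
  have hle : (1 + ratioGap T)⁻¹ ≤ 1 := inv_le_one_of_one_le₀ (by linarith)
  have hsol : ∃ α ∈ Set.Ioc (0 : ℝ) 1, medianThreshold α = T :=
    ⟨(1 + ratioGap T)⁻¹, ⟨by positivity, hle⟩,
      medianThreshold_eq (by positivity) hle hT0 (by field_simp; ring)⟩
  obtain ⟨hpos, hle_one⟩ : alphaMin n ∈ Set.Ioc (0 : ℝ) 1 := Function.invFunOn_mem hsol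
  have heq : medianThreshold (alphaMin n) = T := Function.invFunOn_eq hsol
  obtain ⟨t, ht, h⟩ := exists_ratioGap_eq (div_nonneg (sub_nonneg.2 hle_one) hpos.le)
  rw [← heq, medianThreshold_eq hpos hle_one ht h, h]
  field_simp
  ring

lemma alphaMin_pos (n : ℕ) : 0 < alphaMin n := by
  have := ratioGap_nonneg (Real.sqrt_nonneg (2 * Real.log n))
  rw [alphaMin_eq]
  positivity

lemma sq_sqrt_two_mul_log (n : ℕ) : √(2 * Real.log n) ^ 2 = 2 * Real.log n :=
  Real.sq_sqrt (mul_nonneg two_pos.le (Real.log_natCast_nonneg n))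

lemma inv_le_alphaMin {n : ℕ} (hn : 0 < n) : (7 * n : ℝ)⁻¹ ≤ alphaMin n := by
  have hn' : (1 : ℝ) ≤ n := by exact_mod_cast hn
  have hratio : g √(2 * Real.log n) / phi √(2 * Real.log n) ≤ 6 * n := by
    have h := g_le_exp_mul_phi √(2 * Real.log n)
    rwa [sq_sqrt_two_mul_log, mul_div_cancel_left₀ _ two_ne_zero, Real.exp_log (by linarith),
      ← div_le_iff₀ (phi_pos _)] at h
  have := ratioGap_nonneg (Real.sqrt_nonneg (2 * Real.log n))
  rw [alphaMin_eq]
  gcongr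
  linarith [ratioGap_le_g_div_phi √(2 * Real.log n)]

lemma alphaMin_le {n : ℕ} (hlog : 1 ≤ Real.log n) (hn : 16 * Real.log n ≤ n) :
    alphaMin n ≤ 16 * Real.log n / n := by
  have hn0 : (0 : ℝ) < n := by linarith
  have hphi : phi √(2 * Real.log n) ≤ (2 * n : ℝ)⁻¹ := by
    have h := phi_le √(2 * Real.log n)
    rwa [neg_div, sq_sqrt_two_mul_log, mul_div_cancel_left₀ _ two_ne_zero, Real.exp_neg,
      Real.exp_log hn0, inv_div_left] at h
  have hg : (16 * Real.log n)⁻¹ ≤ g √(2 * Real.log n) := by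
    refine le_trans ?_ (le_g _)
    rw [sq_sqrt_two_mul_log]
    exact inv_anti₀ (by positivity) (by nlinarith [Real.pi_lt_four])
  have hratio : n / (8 * Real.log n) ≤ g √(2 * Real.log n) / phi √(2 * Real.log n) := by
    calc n / (8 * Real.log n) = (16 * Real.log n)⁻¹ / (2 * n : ℝ)⁻¹ := by field_simp; norm_num
      _ ≤ _ := div_le_div₀ (g_pos _).le hg (phi_pos _) hphi
  have hone : 1 ≤ n / (16 * Real.log n) := by rwa [one_le_div (by positivity)]
  have htwo : n / (8 * Real.log n) = 2 * (n / (16 * Real.log n)) := by field_simp; norm_num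
  rw [alphaMin_eq, ← inv_div (n : ℝ)]
  gcongr
  linarith [g_div_phi_sub_two_le_ratioGap (Real.sqrt_nonneg (2 * Real.log n))]

/-! ### The quadratic risk of the posterior -/

/-- A bound for the posterior second moment around `μ` of a coordinate with observation `x`: the
spike contributes `μ²`, and the slab posterior `G_x` has second moment at most `16` around `x`. -/
noncomputable def riskBound (α x μ : ℝ) : ℝ :=
  (1 - postWeight α x) * μ ^ 2 + postWeight α x * (32 + 2 * (x - μ) ^ 2)

lemma slabDensity_le_mul_g (x u : ℝ) : slabDensity u ≤ 4 * (1 + (u - x) ^ 2) * g x := by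
  calc slabDensity u ≤ 2 / (Real.pi * (1 + x ^ 2)) * (1 + (u - x) ^ 2) := slabDensity_le_mul x u
    _ ≤ 4 * (1 + (u - x) ^ 2) * (Real.pi * (2 + x ^ 2))⁻¹ := by
        rw [mul_right_comm, ← div_eq_mul_inv]
        gcongr ?_ * _
        rw [div_le_div_iff₀ (by positivity) (by positivity)]
        nlinarith [Real.pi_pos, mul_nonneg Real.pi_pos.le (sq_nonneg x)]
    _ ≤ _ := by
        gcongr
        exact le_g x

lemma lintegral_slabPosterior_sub_sq_le (x : ℝ) :
    ∫⁻ u, ENNReal.ofReal ((u - x) ^ 2) ∂slabPosterior x ≤ ENNReal.ofReal 16 := by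
  have hint := fun k => integrable_sub_pow_gaussianReal x x k
  have hint' : Integrable (fun u => 4 * ((u - x) ^ 2 + (u - x) ^ 4)) (gaussianReal x 1) :=
    ((hint 2).add (hint 4)).const_mul 4
  have hle : ∀ u, phi (x - u) * slabDensity u / g x * (u - x) ^ 2 ≤
      phi (x - u) * (4 * ((u - x) ^ 2 + (u - x) ^ 4)) := fun u => by
    have h : slabDensity u / g x ≤ 4 * (1 + (u - x) ^ 2) :=
      (div_le_iff₀ (g_pos x)).2 (slabDensity_le_mul_g x u)
    have hφ := phi_pos (x - u)
    calc phi (x - u) * slabDensity u / g x * (u - x) ^ 2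
        = phi (x - u) * (slabDensity u / g x * (u - x) ^ 2) := by ring
      _ ≤ phi (x - u) * (4 * (1 + (u - x) ^ 2) * (u - x) ^ 2) := by gcongr
      _ = _ := by ring
  rw [slabPosterior, lintegral_withDensity_eq_lintegral_mul _ (by fun_prop) (by fun_prop)]
  calc _ ≤ ∫⁻ u, ENNReal.ofReal (phi (x - u) * (4 * ((u - x) ^ 2 + (u - x) ^ 4))) := by
        refine lintegral_mono fun u => ?_
        rw [Pi.mul_apply, ← ENNReal.ofReal_mul (div_nonneg (mul_nonneg (phi_pos _).le
          (slabDensity_pos _).le) (g_pos x).le)]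
        exact ENNReal.ofReal_le_ofReal (hle u)
    _ = ENNReal.ofReal (∫ u, 4 * ((u - x) ^ 2 + (u - x) ^ 4) ∂gaussianReal x 1) := by
        rw [integral_gaussianReal_eq, ofReal_integral_eq_lintegral_ofReal
          (integrable_gaussianReal_iff.1 hint') (.of_forall fun u => by
            have := phi_pos (x - u)
            positivity)]
    _ = ENNReal.ofReal 16 := by
        rw [integral_const_mul, integral_add (hint 2) (hint 4), integral_sub_sq_gaussianReal,
          integral_sub_pow_four_gaussianReal]
        norm_num

lemma lintegral_slabPosterior_sub_sq_le_add (x μ : ℝ) :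
    ∫⁻ u, ENNReal.ofReal ((u - μ) ^ 2) ∂slabPosterior x ≤
      ENNReal.ofReal (32 + 2 * (x - μ) ^ 2) := by
  calc _ ≤ ∫⁻ u, (ENNReal.ofReal 2 * ENNReal.ofReal ((u - x) ^ 2)
        + ENNReal.ofReal (2 * (x - μ) ^ 2)) ∂slabPosterior x := by
        refine lintegral_mono fun u => ?_
        rw [← ENNReal.ofReal_mul (by norm_num), ← ENNReal.ofReal_add (by positivity)
          (by positivity)]
        exact ENNReal.ofReal_le_ofReal (by nlinarith [sq_nonneg (u - x - (x - μ))])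
    _ ≤ ENNReal.ofReal 2 * ENNReal.ofReal 16 + ENNReal.ofReal (2 * (x - μ) ^ 2) := by
        rw [lintegral_add_left (by fun_prop), lintegral_const_mul _ (by fun_prop),
          lintegral_const, measure_univ, mul_one]
        gcongr
        exact lintegral_slabPosterior_sub_sq_le x
    _ = _ := by
        rw [← ENNReal.ofReal_mul (by norm_num), ← ENNReal.ofReal_add (by norm_num) (by positivity)]
        norm_num

section

variable {α : ℝ}

lemma riskBound_nonneg (h0 : 0 ≤ α) (h1 : α ≤ 1) (x μ : ℝ) : 0 ≤ riskBound α x μ :=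
  add_nonneg (mul_nonneg (one_sub_postWeight_nonneg h0 h1 x) (sq_nonneg μ))
    (mul_nonneg (postWeight_nonneg h0 h1 x) (by positivity))

lemma lintegral_coordPosterior_sub_sq_le (h0 : 0 ≤ α) (h1 : α ≤ 1) (x μ : ℝ) :
    ∫⁻ u, ENNReal.ofReal ((u - μ) ^ 2) ∂coordPosterior α x ≤ ENNReal.ofReal (riskBound α x μ) := by
  have ha := postWeight_nonneg h0 h1 x
  have ha' := one_sub_postWeight_nonneg h0 h1 x
  rw [riskBound, coordPosterior, lintegral_add_measure, lintegral_smul_measure,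
    lintegral_smul_measure, lintegral_dirac' _ (by fun_prop), smul_eq_mul, smul_eq_mul,
    ENNReal.ofReal_add (by positivity) (by positivity), ENNReal.ofReal_mul ha',
    ENNReal.ofReal_mul ha, zero_sub, neg_sq]
  gcongr
  exact lintegral_slabPosterior_sub_sq_le_add x μ

lemma lintegral_posterior_le {n : ℕ} (h0 : 0 ≤ α) (h1 : α ≤ 1) (X θ₀ : Fin n → ℝ) :
    ∫⁻ θ, ENNReal.ofReal (∑ i, (θ i - θ₀ i) ^ 2) ∂posterior α X ≤
      ENNReal.ofReal (∑ i, riskBound α (X i) (θ₀ i)) := by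
  have := fun i => isProbabilityMeasure_coordPosterior h0 h1 (X i)
  calc _ = ∑ i, ∫⁻ θ, ENNReal.ofReal ((θ i - θ₀ i) ^ 2) ∂posterior α X := by
        simp_rw [ENNReal.ofReal_sum_of_nonneg fun _ _ => sq_nonneg _]
        exact lintegral_finsetSum _ fun i _ => by fun_prop
    _ = ∑ i, ∫⁻ u, ENNReal.ofReal ((u - θ₀ i) ^ 2) ∂coordPosterior α (X i) :=
        Finset.sum_congr rfl fun i _ =>
          (measurePreserving_eval (fun i => coordPosterior α (X i)) i).lintegral_comp
            (f := fun u => ENNReal.ofReal ((u - θ₀ i) ^ 2)) (by fun_prop)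
    _ ≤ _ := by
        rw [ENNReal.ofReal_sum_of_nonneg fun _ _ => riskBound_nonneg h0 h1 _ _]
        exact Finset.sum_le_sum fun i _ => lintegral_coordPosterior_sub_sq_le h0 h1 _ _

-- Above the level `x² = 4 log (32 / α)` the spike weight `1 - a` decays exponentially in `x²`.
lemma one_sub_postWeight_mul_sq_le (h0 : 0 < α) (h1 : α ≤ 1) (x : ℝ) :
    (1 - postWeight α x) * x ^ 2 ≤ 4 * Real.log (32 / α) + 4 := by
  set y := x ^ 2 - 4 * Real.log (32 / α) with hy
  have ha := postWeight_nonneg h0.le h1 x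
  have hlog : 0 ≤ Real.log (32 / α) := Real.log_nonneg ((one_le_div h0).2 (by linarith))
  have hexp : 1 - postWeight α x ≤ Real.exp (-(y / 4)) := by
    have hsplit : Real.exp (-(y / 4)) = 32 / α / Real.exp (x ^ 2 / 4) := by
      rw [hy, eq_div_iff (Real.exp_ne_zero _), ← Real.exp_add, ← Real.exp_log (by positivity :
        0 < 32 / α), Real.log_exp]
      ring_nf
    have hg := exp_mul_phi_le x
    have hφ := phi_pos x
    rw [hsplit, one_sub_postWeight h0.le h1, div_div, div_le_div_iff₀
      (mixture_pos h0.le h1 x) (by positivity)]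
    nlinarith [mul_nonneg (sub_nonneg.2 h1) hφ.le, mul_le_mul_of_nonneg_left hg h0.le,
      mul_pos (mul_pos h0 h0) (mul_pos (Real.exp_pos (x ^ 2 / 4)) hφ)]
  have hexcess : (1 - postWeight α x) * y ≤ 4 := by
    rcases le_total y 0 with h | h
    · exact (mul_nonpos_of_nonneg_of_nonpos (one_sub_postWeight_nonneg h0.le h1 x) h).trans
        (by norm_num)
    · calc (1 - postWeight α x) * y ≤ Real.exp (-(y / 4)) * y := by gcongr
        _ = y * Real.exp (-(y / 4)) := mul_comm _ _
        _ ≤ 4 := mul_exp_neg_div_le (by norm_num) y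
  nlinarith

lemma riskBound_le (h0 : 0 < α) (h1 : α ≤ 1) (x μ : ℝ) :
    riskBound α x μ ≤ 8 * Real.log (32 / α) + 40 + 4 * (x - μ) ^ 2 := by
  have hspike := one_sub_postWeight_mul_sq_le h0 h1 x
  have ha' := one_sub_postWeight_nonneg h0.le h1 x
  have hμ : μ ^ 2 ≤ 2 * x ^ 2 + 2 * (x - μ) ^ 2 := by nlinarith [sq_nonneg (x + (x - μ))]
  rw [riskBound]
  nlinarith [mul_le_mul_of_nonneg_left hμ ha', sq_nonneg (x - μ)]

end

/-! ### The score of the log-marginal likelihood -/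

/-- The level `ζ(α)` with `exp (ζ(α)² / 4) = 32 / α`, beyond which an observation is dominated by
the slab: `φ(x) ≤ α g(x)` for `|x| ≥ ζ(α)`. -/
noncomputable def cutoff (α : ℝ) : ℝ := √(4 * Real.log (32 / α))

/-- The derivative in `α` of the log-marginal likelihood `log ((1 - α) φ(x) + α g(x))` of a single
observation `x`. -/
noncomputable def scoreTerm (α x : ℝ) : ℝ := (g x - phi x) / ((1 - α) * phi x + α * g x)

@[fun_prop]
lemma measurable_scoreTerm (α : ℝ) : Measurable (scoreTerm α) := by
  unfold scoreTerm
  fun_prop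

section

variable {α : ℝ}

lemma two_le_log_div (h0 : 0 < α) (h1 : α ≤ 1) : 2 ≤ Real.log (32 / α) := by
  have h32 : Real.log 32 = 5 * Real.log 2 := by
    rw [show (32 : ℝ) = 2 ^ 5 by norm_num, Real.log_pow]
    norm_num
  have hle : Real.log 32 ≤ Real.log (32 / α) :=
    Real.log_le_log (by norm_num) ((le_div_iff₀ h0).2 (by linarith))
  linarith [Real.log_two_gt_d9]

lemma cutoff_sq (h0 : 0 < α) (h1 : α ≤ 1) : cutoff α ^ 2 = 4 * Real.log (32 / α) :=
  Real.sq_sqrt (by linarith [two_le_log_div h0 h1])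

lemma one_le_cutoff (h0 : 0 < α) (h1 : α ≤ 1) : 1 ≤ cutoff α :=
  Real.le_sqrt_of_sq_le (by linarith [two_le_log_div h0 h1])

lemma le_exp_of_cutoff_le (h0 : 0 < α) (h1 : α ≤ 1) {x : ℝ} (hx : cutoff α ≤ |x|) :
    32 / α ≤ Real.exp (x ^ 2 / 4) := by
  rw [← Real.log_le_iff_le_exp (by positivity)]
  have h : cutoff α ^ 2 ≤ x ^ 2 := by
    rw [← sq_abs x]
    exact pow_le_pow_left₀ (Real.sqrt_nonneg _) hx 2
  linarith [cutoff_sq h0 h1]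

lemma phi_le_mul_g (h0 : 0 < α) (h1 : α ≤ 1) {x : ℝ} (hx : cutoff α ≤ |x|) :
    phi x ≤ α * g x := by
  have h : 32 / α * phi x ≤ 32 * g x := by
    refine le_trans ?_ (exp_mul_phi_le x)
    have := phi_pos x
    gcongr
    exact le_exp_of_cutoff_le h0 h1 hx
  rw [div_mul_eq_mul_div, div_le_iff₀ h0] at h
  linarith

lemma scoreTerm_le (h0 : 0 < α) (h1 : α ≤ 1) (x : ℝ) : scoreTerm α x ≤ 1 / α := by
  rw [scoreTerm, div_le_div_iff₀ (mixture_pos h0.le h1 x) h0]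
  linarith [phi_pos x]

lemma neg_two_le_scoreTerm (h0 : 0 < α) (h1 : α ≤ 1 / 2) (x : ℝ) : -2 ≤ scoreTerm α x := by
  rw [scoreTerm, le_div_iff₀ (mixture_pos h0.le (by linarith) x)]
  nlinarith [phi_pos x, g_pos x, mul_pos h0 (g_pos x)]

lemma le_scoreTerm (h0 : 0 < α) (h1 : α ≤ 1 / 2) {x : ℝ} (hx : cutoff α ≤ |x|) :
    1 / (4 * α) ≤ scoreTerm α x := by
  have h := phi_le_mul_g h0 (by linarith) hx
  rw [scoreTerm, div_le_div_iff₀ (by positivity) (mixture_pos h0.le (by linarith) x)]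
  nlinarith [g_pos x, mul_pos h0 (g_pos x), mul_pos h0 (phi_pos x)]

lemma integrable_exp_mul_scoreTerm (h0 : 0 < α) (h1 : α ≤ 1) {t : ℝ} (ht : 0 ≤ t) (m : ℝ) :
    Integrable (fun x => Real.exp (t * scoreTerm α x)) (gaussianReal m 1) := by
  refine .of_bound (by fun_prop) (Real.exp (t * (1 / α))) (.of_forall fun x => ?_)
  rw [Real.norm_eq_abs, Real.abs_exp]
  gcongr
  exact scoreTerm_le h0 h1 x

-- The log-marginal likelihood is concave in `α`, and `(αhat - α) * ∑ i, scoreTerm α (X i)` is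
-- the increment of its tangent at `α`.
lemma mle_sub_mul_score_nonneg {n : ℕ} {αhat : (Fin n → ℝ) → ℝ} (h : IsMarginalMLE αhat)
    (hα : α ∈ Set.Icc (alphaMin n) 1) (X : Fin n → ℝ) :
    0 ≤ (αhat X - α) * ∑ i, scoreTerm α (X i) := by
  have h0 : 0 ≤ α := (alphaMin_pos n).le.trans hα.1
  have h0' : 0 ≤ αhat X := (alphaMin_pos n).le.trans (h X).1.1
  calc 0 ≤ logMarginal (αhat X) X - logMarginal α X := sub_nonneg.2 ((h X).2 hα)
    _ ≤ _ := by
        rw [logMarginal, logMarginal, ← Finset.sum_sub_distrib, Finset.mul_sum]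
        refine Finset.sum_le_sum fun i _ => ?_
        have hD := mixture_pos h0 hα.2 (X i)
        have hD' := mixture_pos h0' (h X).1.2 (X i)
        rw [← Real.log_div hD'.ne' hD.ne']
        refine (Real.log_le_sub_one_of_pos (div_pos hD' hD)).trans_eq ?_
        rw [scoreTerm, mul_div_assoc', div_sub_one hD.ne']
        ring_nf

/-! ### Expectations at a null coordinate -/

lemma phi_mul_postWeight_mul_le (h0 : 0 < α) (h1 : α ≤ 1 / 2) (x : ℝ) :
    phi x * (postWeight α x * (1 + x ^ 2)) ≤ 3 * α := by
  have hφ := phi_pos x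
  have hg := g_pos x
  have hD := mixture_pos h0.le (by linarith : α ≤ 1) x
  have hratio : phi x * postWeight α x ≤ 2 * α * g x := by
    rw [postWeight, mul_div_assoc', div_le_iff₀ hD]
    have hDφ : phi x ≤ 2 * ((1 - α) * phi x + α * g x) := by nlinarith [mul_pos h0 hg]
    nlinarith [mul_le_mul_of_nonneg_left hDφ (mul_pos h0 hg).le]
  have hdecay : g x * (1 + x ^ 2) ≤ 3 / 2 := by
    have h := g_le x
    rw [← div_div, le_div_iff₀ (by positivity)] at h
    refine h.trans ?_
    rw [div_le_iff₀ Real.pi_pos]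
    linarith [Real.pi_gt_three]
  calc phi x * (postWeight α x * (1 + x ^ 2)) = phi x * postWeight α x * (1 + x ^ 2) := by ring
    _ ≤ 2 * α * g x * (1 + x ^ 2) := by gcongr
    _ = 2 * α * (g x * (1 + x ^ 2)) := by ring
    _ ≤ 2 * α * (3 / 2) := by gcongr
    _ = 3 * α := by ring

lemma phi_mul_one_add_sq_le (h0 : 0 < α) (h1 : α ≤ 1) {x : ℝ} (hx : cutoff α ≤ |x|) :
    phi x * (1 + x ^ 2) ≤ α / 8 * Real.exp (-(1 / 8) * x ^ 2) := by
  have hexp : Real.exp (-x ^ 2 / 2) * Real.exp (x ^ 2 / 8)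
      = Real.exp (-(1 / 8) * x ^ 2) * (Real.exp (x ^ 2 / 4))⁻¹ := by
    rw [← Real.exp_neg, ← Real.exp_add, ← Real.exp_add]
    ring_nf
  calc phi x * (1 + x ^ 2) ≤ Real.exp (-x ^ 2 / 2) / 2 * (8 * Real.exp (x ^ 2 / 8)) := by
        gcongr
        exacts [phi_le x, one_add_sq_le_exp (by norm_num) x]
    _ = 4 * Real.exp (-(1 / 8) * x ^ 2) * (Real.exp (x ^ 2 / 4))⁻¹ := by
        linear_combination 4 * hexp
    _ ≤ 4 * Real.exp (-(1 / 8) * x ^ 2) * (32 / α)⁻¹ := by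
        gcongr
        exact le_exp_of_cutoff_le h0 h1 hx
    _ = α / 8 * Real.exp (-(1 / 8) * x ^ 2) := by
        rw [inv_div]
        ring

lemma phi_sub_mul_postWeight_mul_le (h0 : 0 < α) (h1 : α ≤ 1 / 2) (x : ℝ) :
    phi (0 - x) * (postWeight α x * (1 + x ^ 2)) ≤
      (Set.Icc (-cutoff α) (cutoff α)).indicator (fun _ => 3 * α) x
        + α / 8 * Real.exp (-(1 / 8) * x ^ 2) := by
  rw [zero_sub, phi_neg]
  by_cases hx : x ∈ Set.Icc (-cutoff α) (cutoff α)
  · rw [Set.indicator_of_mem hx]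
    exact (phi_mul_postWeight_mul_le h0 h1 x).trans (le_add_of_nonneg_right (by positivity))
  · rw [Set.indicator_of_notMem hx, zero_add]
    refine le_trans ?_ (phi_mul_one_add_sq_le h0 (by linarith) (not_le.1 (hx ∘ abs_le.1)).le)
    gcongr
    · exact (phi_pos x).le
    · exact mul_le_of_le_one_left (by positivity) (postWeight_le_one h0.le (by linarith) x)

lemma integrable_postWeight_mul_one_add_sq (h0 : 0 ≤ α) (h1 : α ≤ 1) (m : ℝ) :
    Integrable (fun x => postWeight α x * (1 + x ^ 2)) (gaussianReal m 1) := by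
  refine ((integrable_const 1).add (integrable_pow_gaussianReal m 2)).bdd_mul (c := 1)
    (by fun_prop) (.of_forall fun x => ?_)
  rw [Real.norm_of_nonneg (postWeight_nonneg h0 h1 x)]
  exact postWeight_le_one h0 h1 x

lemma integral_postWeight_mul_one_add_sq_le (h0 : 0 < α) (h1 : α ≤ 1 / 2) :
    ∫ x, postWeight α x * (1 + x ^ 2) ∂gaussianReal 0 1 ≤ 7 * α * cutoff α := by
  have hζ := one_le_cutoff h0 (by linarith)
  set ζ := cutoff α
  have hcentre : Integrable ((Set.Icc (-ζ) ζ).indicator fun _ : ℝ => 3 * α) :=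
    (integrable_indicator_iff measurableSet_Icc).2 (integrableOn_const (by simp))
  have htail : Integrable fun x : ℝ => α / 8 * Real.exp (-(1 / 8) * x ^ 2) :=
    (integrable_exp_neg_mul_sq (by norm_num)).const_mul _
  have hsqrt : √(Real.pi / (1 / 8)) ≤ 8 :=
    Real.sqrt_le_iff.2 ⟨by norm_num, by linarith [Real.pi_lt_four]⟩
  calc ∫ x, postWeight α x * (1 + x ^ 2) ∂gaussianReal 0 1
      ≤ ∫ x, ((Set.Icc (-ζ) ζ).indicator (fun _ => 3 * α) x
          + α / 8 * Real.exp (-(1 / 8) * x ^ 2)) := by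
        rw [integral_gaussianReal_eq]
        exact integral_mono (integrable_gaussianReal_iff.1
          (integrable_postWeight_mul_one_add_sq h0.le (by linarith) 0)) (hcentre.add htail)
          (phi_sub_mul_postWeight_mul_le h0 h1)
    _ = 2 * ζ * (3 * α) + α / 8 * √(Real.pi / (1 / 8)) := by
        rw [integral_add hcentre htail, integral_indicator measurableSet_Icc, setIntegral_const,
          Real.volume_real_Icc_of_le (by linarith), integral_const_mul, integral_gaussian,
          smul_eq_mul]
        ring
    _ ≤ 2 * ζ * (3 * α) + α * ζ := by
        refine add_le_add_right ?_ _
        calc α / 8 * √(Real.pi / (1 / 8)) ≤ α / 8 * 8 := by gcongr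
          _ ≤ α * ζ := by nlinarith
    _ = 7 * α * ζ := by ring

lemma one_sub_mul_exp_half_le {y : ℝ} (h0 : -(1 / 2) ≤ y) (h1 : y ≤ 1) :
    (1 - y) * Real.exp (y / 2) ≤ 1 - y / 2 - y ^ 2 / 8 := by
  have hexp : Real.exp (y / 2) ≤ 1 + y / 2 + (y / 2) ^ 2 := by
    have := Real.abs_exp_sub_one_sub_id_le (x := y / 2) (abs_le.2 ⟨by linarith, by linarith⟩)
    linarith [(abs_le.1 this).2]
  calc (1 - y) * Real.exp (y / 2) ≤ (1 - y) * (1 + y / 2 + (y / 2) ^ 2) := by gcongr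
    _ ≤ 1 - y / 2 - y ^ 2 / 8 := by
        nlinarith [mul_nonneg (sq_nonneg y) (by linarith : 0 ≤ y + 1 / 2)]

-- With `y = α * scoreTerm α x`, the mixture density `D` satisfies `φ = D * (1 - y)`.
lemma phi_mul_exp_scoreTerm_le (h0 : 0 < α) (h1 : α ≤ 1 / 3) (x : ℝ) :
    phi x * Real.exp (α / 2 * scoreTerm α x) ≤ phi x + α / 2 * (g x - phi x)
      - α ^ 2 / 8 * ((g x - phi x) * scoreTerm α x) := by
  have hφ := phi_pos x
  have hg := g_pos x
  have hD := mixture_pos h0.le (by linarith : α ≤ 1) x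
  obtain ⟨D, hD_def⟩ : ∃ D, D = (1 - α) * phi x + α * g x := ⟨_, rfl⟩
  obtain ⟨y, hy⟩ : ∃ y, y = α * scoreTerm α x := ⟨_, rfl⟩
  rw [← hD_def] at hD
  have hyD : y * D = α * (g x - phi x) := by
    rw [hy, scoreTerm, ← hD_def, mul_assoc, div_mul_cancel₀ _ hD.ne']
  have hφD : phi x = D * (1 - y) := by linear_combination hyD - hD_def
  have hy1 : y ≤ 1 := by nlinarith
  have hy0 : -(1 / 2) ≤ y := by nlinarith
  calc phi x * Real.exp (α / 2 * scoreTerm α x) = D * ((1 - y) * Real.exp (y / 2)) := by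
        rw [← mul_assoc, ← hφD, hy, div_mul_eq_mul_div]
    _ ≤ D * (1 - y / 2 - y ^ 2 / 8) := by
        gcongr
        exact one_sub_mul_exp_half_le hy0 hy1
    _ = _ := by linear_combination hD_def - (1 / 2 + y / 8) * hyD - α * (g x - phi x) / 8 * hy

lemma indicator_g_le (h0 : 0 < α) (h1 : α ≤ 1 / 3) (x : ℝ) :
    α / 48 * {y : ℝ | cutoff α ≤ |y|}.indicator g x ≤
      α ^ 2 / 8 * ((g x - phi x) * scoreTerm α x) := by
  have hg := g_pos x
  by_cases hx : cutoff α ≤ |x|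
  · rw [Set.indicator_of_mem (show x ∈ {y : ℝ | cutoff α ≤ |y|} from hx)]
    have hgap : 2 / 3 * g x ≤ g x - phi x := by nlinarith [phi_le_mul_g h0 (by linarith) hx]
    calc α / 48 * g x = α ^ 2 / 8 * (2 / 3 * g x * (1 / (4 * α))) := by
          field_simp
          norm_num
      _ ≤ _ := by
          gcongr
          exacts [(by positivity : (0 : ℝ) ≤ 2 / 3 * g x).trans hgap,
            le_scoreTerm h0 (by linarith) hx]
  · rw [Set.indicator_of_notMem (show x ∉ {y : ℝ | cutoff α ≤ |y|} from hx), mul_zero, scoreTerm,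
      mul_div_assoc', ← sq]
    have := mixture_pos h0.le (by linarith : α ≤ 1) x
    positivity

lemma le_setIntegral_g {t : ℝ} (ht : 1 ≤ t) : 1 / (20 * t) ≤ ∫ x in {y : ℝ | t ≤ |y|}, g x := by
  have hsub : Set.Icc t (2 * t) ⊆ {y : ℝ | t ≤ |y|} := fun y hy => hy.1.trans (le_abs_self y)
  calc 1 / (20 * t) = ∫ x in Set.Icc t (2 * t), 1 / (20 * t ^ 2) := by
        rw [setIntegral_const, Real.volume_real_Icc_of_le (by linarith), smul_eq_mul]
        field_simp
        ring
    _ ≤ ∫ x in Set.Icc t (2 * t), g x := by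
        refine setIntegral_mono_on (integrableOn_const (by simp)) integrable_g.integrableOn
          measurableSet_Icc fun x hx => le_trans ?_ (le_g x)
        rw [← one_div]
        refine one_div_le_one_div_of_le (by positivity) ?_
        nlinarith [Real.pi_pos, Real.pi_lt_d2, mul_self_le_mul_self (by linarith [hx.1]) hx.2]
    _ ≤ _ := setIntegral_mono_set integrable_g.integrableOn
        (.of_forall fun x => (g_pos x).le) hsub.eventuallyLE

lemma mgf_scoreTerm_half_le (h0 : 0 < α) (h1 : α ≤ 1 / 3) :
    mgf (scoreTerm α) (gaussianReal 0 1) (α / 2) ≤ Real.exp (-(α / (960 * cutoff α))) := by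
  have hζ := one_le_cutoff h0 (by linarith)
  have hms : MeasurableSet {y : ℝ | cutoff α ≤ |y|} := measurableSet_le (by fun_prop) (by fun_prop)
  have hdiff : Integrable fun x => α / 2 * (g x - phi x) :=
    (integrable_g.sub integrable_phi).const_mul _
  have hsum : Integrable fun x => phi x + α / 2 * (g x - phi x) := integrable_phi.add hdiff
  have htail : Integrable fun x => α / 48 * {y : ℝ | cutoff α ≤ |y|}.indicator g x :=
    (integrable_g.indicator hms).const_mul _
  have hexp := integrable_exp_mul_scoreTerm h0 (by linarith) (t := α / 2) (by positivity) 0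
  rw [mgf, integral_gaussianReal_eq]
  calc ∫ x, phi (0 - x) * Real.exp (α / 2 * scoreTerm α x)
      ≤ ∫ x, (phi x + α / 2 * (g x - phi x)
          - α / 48 * {y : ℝ | cutoff α ≤ |y|}.indicator g x) := by
        refine integral_mono (integrable_gaussianReal_iff.1 hexp) (hsum.sub htail) fun x => ?_
        simp only [zero_sub, phi_neg]
        exact (phi_mul_exp_scoreTerm_le h0 h1 x).trans
          (sub_le_sub_left (indicator_g_le h0 h1 x) _)
    _ = 1 - α / 48 * ∫ x in {y : ℝ | cutoff α ≤ |y|}, g x := by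
        rw [integral_sub hsum htail, integral_const_mul, integral_indicator hms,
          integral_add integrable_phi hdiff, integral_const_mul,
          integral_sub integrable_g integrable_phi, integral_phi, integral_g]
        ring
    _ ≤ 1 - α / 48 * (1 / (20 * cutoff α)) := by
        gcongr
        exact le_setIntegral_g hζ
    _ = -(α / (960 * cutoff α)) + 1 := by
        field_simp
        ring
    _ ≤ _ := Real.add_one_le_exp _

end

/-! ### Lower bound on the estimated weight -/

/-- The indicator that the noise of an observation `x` with mean `μ` exceeds `t`. -/
noncomputable def noiseExceeds (t μ x : ℝ) : ℝ := {y : ℝ | t < |y - μ|}.indicator 1 x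

@[fun_prop]
lemma measurable_noiseExceeds (t μ : ℝ) : Measurable (noiseExceeds t μ) :=
  measurable_one.indicator (measurableSet_lt (by fun_prop) (by fun_prop))

lemma noiseExceeds_of_lt {t μ x : ℝ} (h : t < |x - μ|) : noiseExceeds t μ x = 1 :=
  Set.indicator_of_mem (s := {y : ℝ | t < |y - μ|}) h _

lemma noiseExceeds_of_le {t μ x : ℝ} (h : |x - μ| ≤ t) : noiseExceeds t μ x = 0 :=
  Set.indicator_of_notMem (s := {y : ℝ | t < |y - μ|}) (not_lt.2 h) _

lemma exp_noiseExceeds_le {t : ℝ} (ht0 : 0 ≤ t) (ht : 8 ≤ t ^ 2) (μ x : ℝ) :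
    Real.exp (noiseExceeds t μ x) ≤ 1 + (x - μ) ^ 2 / 4 := by
  rcases le_or_gt |x - μ| t with h | h
  · rw [noiseExceeds_of_le h, Real.exp_zero]
    exact le_add_of_nonneg_right (by positivity)
  · have hsq : t ^ 2 ≤ (x - μ) ^ 2 := by
      rw [← sq_abs (x - μ)]
      exact pow_le_pow_left₀ ht0 h.le 2
    rw [noiseExceeds_of_lt h]
    linarith [Real.exp_one_lt_d9]

lemma integrable_exp_noiseExceeds (t μ : ℝ) :
    Integrable (fun x => Real.exp (1 * noiseExceeds t μ x)) (gaussianReal μ 1) := by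
  refine .of_bound (by fun_prop) (Real.exp 1) (.of_forall fun x => ?_)
  rw [Real.norm_eq_abs, Real.abs_exp, one_mul, Real.exp_le_exp]
  exact Set.indicator_apply_le' (fun _ => le_rfl) fun _ => zero_le_one

lemma mgf_noiseExceeds_one_le {t : ℝ} (ht0 : 0 ≤ t) (ht : 8 ≤ t ^ 2) (μ : ℝ) :
    mgf (noiseExceeds t μ) (gaussianReal μ 1) 1 ≤ Real.exp (1 / 4) := by
  have hsq : Integrable (fun x => (x - μ) ^ 2 / 4) (gaussianReal μ 1) :=
    (integrable_sub_pow_gaussianReal μ μ 2).div_const 4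
  calc mgf (noiseExceeds t μ) (gaussianReal μ 1) 1
      ≤ ∫ x, (1 + (x - μ) ^ 2 / 4) ∂gaussianReal μ 1 :=
        integral_mono (integrable_exp_noiseExceeds t μ) ((integrable_const 1).add hsq) fun x => by
          simpa only [one_mul] using exp_noiseExceeds_le ht0 ht μ x
    _ = 1 / 4 + 1 := by
        rw [integral_add (integrable_const 1) hsq, integral_div, integral_sub_sq_gaussianReal]
        simp [add_comm]
    _ ≤ Real.exp (1 / 4) := Real.add_one_le_exp _

section

variable {n : ℕ} {αhat : (Fin n → ℝ) → ℝ} {θ X : Fin n → ℝ} {K : Finset (Fin n)} {α t : ℝ}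

/-- The event that at least half of the coordinates in `K` have a noise larger than `t`; off this
event the large means in `K` are visible in the data. -/
def noisySet (θ : Fin n → ℝ) (K : Finset (Fin n)) (t : ℝ) : Set (Fin n → ℝ) :=
  {X | (K.card : ℝ) / 2 ≤ ∑ i ∈ K, noiseExceeds t (θ i) (X i)}

lemma measurableSet_noisySet (θ : Fin n → ℝ) (K : Finset (Fin n)) (t : ℝ) :
    MeasurableSet (noisySet θ K t) :=
  measurableSet_le (by fun_prop) (by fun_prop)

lemma dataLaw_real_noisySet_le (θ : Fin n → ℝ) (K : Finset (Fin n)) (ht0 : 0 ≤ t)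
    (ht : 8 ≤ t ^ 2) : (dataLaw θ).real (noisySet θ K t) ≤ Real.exp (-(K.card / 4)) := by
  refine (measureReal_pi_le_exp_sum_sub (μ := fun i => gaussianReal (θ i) 1)
    (h := fun i => noiseExceeds t (θ i)) (fun i => by fun_prop) zero_le_one
    (fun i _ => integrable_exp_noiseExceeds t (θ i))
    (fun i _ => mgf_noiseExceeds_one_le ht0 ht (θ i)) _).trans_eq ?_
  rw [Finset.sum_const, nsmul_eq_mul]
  ring_nf

lemma one_sub_noiseExceeds_mul_le_scoreTerm (h0 : 0 < α) (h1 : α ≤ 1 / 2) {μ : ℝ}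
    (hμ : 2 * cutoff α ≤ |μ|) (x : ℝ) :
    (1 - noiseExceeds (cutoff α) μ x) * (1 / (4 * α)) ≤ scoreTerm α x + 2 := by
  rcases le_or_gt |x - μ| (cutoff α) with hnoise | hnoise
  · have hx : cutoff α ≤ |x| := by
      have := abs_sub_abs_le_abs_sub μ x
      rw [abs_sub_comm] at this
      linarith
    rw [noiseExceeds_of_le hnoise]
    linarith [le_scoreTerm h0 h1 hx]
  · rw [noiseExceeds_of_lt hnoise]
    linarith [neg_two_le_scoreTerm h0 h1 x]

lemma sum_scoreTerm_pos (h0 : 0 < α) (h1 : α ≤ 1 / 2) (hK : 16 * α * n < K.card)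
    (hθ : ∀ i ∈ K, 2 * cutoff α ≤ |θ i|) (hX : X ∉ noisySet θ K (cutoff α)) :
    0 < ∑ i, scoreTerm α (X i) := by
  have hnoise : ∑ i ∈ K, noiseExceeds (cutoff α) (θ i) (X i) < (K.card : ℝ) / 2 := not_le.1 hX
  have hsum : (K.card - ∑ i ∈ K, noiseExceeds (cutoff α) (θ i) (X i)) * (1 / (4 * α)) ≤
      ∑ i, scoreTerm α (X i) + 2 * n := by
    calc _ = ∑ i ∈ K, (1 - noiseExceeds (cutoff α) (θ i) (X i)) * (1 / (4 * α)) := by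
          simp [← Finset.sum_mul]
      _ ≤ ∑ i ∈ K, (scoreTerm α (X i) + 2) := Finset.sum_le_sum fun i hi =>
          one_sub_noiseExceeds_mul_le_scoreTerm h0 h1 (hθ i hi) (X i)
      _ ≤ ∑ i, (scoreTerm α (X i) + 2) :=
          Finset.sum_le_sum_of_subset_of_nonneg (Finset.subset_univ K) fun i _ _ => by
            linarith [neg_two_le_scoreTerm h0 h1 (X i)]
      _ = _ := by simp [Finset.sum_add_distrib, mul_comm]
  have hmass : 2 * n < (K.card : ℝ) / 2 * (1 / (4 * α)) := by
    rw [mul_one_div, lt_div_iff₀ (by positivity)]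
    linarith
  have hhalf : (K.card : ℝ) / 2 * (1 / (4 * α)) ≤
      (K.card - ∑ i ∈ K, noiseExceeds (cutoff α) (θ i) (X i)) * (1 / (4 * α)) := by
    gcongr
    linarith
  linarith

lemma le_mle_of_notMem_noisySet (h : IsMarginalMLE αhat) (h0 : 0 < α) (h1 : α ≤ 1 / 2)
    (hK : 16 * α * n < K.card) (hθ : ∀ i ∈ K, 2 * cutoff α ≤ |θ i|)
    (hX : X ∉ noisySet θ K (cutoff α)) : α ≤ αhat X := by
  rcases le_total α (alphaMin n) with hle | hle
  · exact hle.trans (h X).1.1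
  · exact sub_nonneg.1 (nonneg_of_mul_nonneg_left
      (mle_sub_mul_score_nonneg h ⟨hle, by linarith⟩ X) (sum_scoreTerm_pos h0 h1 hK hθ hX))

/-! ### Upper bound on the estimated weight -/

/-- The event that the score at `α` is nonnegative; off this event the estimated weight is at
most `α`. -/
def scoreNonnegSet (n : ℕ) (α : ℝ) : Set (Fin n → ℝ) := {X | 0 ≤ ∑ i, scoreTerm α (X i)}

lemma measurableSet_scoreNonnegSet (n : ℕ) (α : ℝ) : MeasurableSet (scoreNonnegSet n α) :=
  measurableSet_le (by fun_prop) (by fun_prop)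

lemma mle_le_of_notMem_scoreNonnegSet (h : IsMarginalMLE αhat)
    (hα : α ∈ Set.Icc (alphaMin n) 1) (hX : X ∉ scoreNonnegSet n α) : αhat X ≤ α := by
  by_contra! hlt
  exact (mle_sub_mul_score_nonneg h hα X).not_gt
    (mul_neg_of_pos_of_neg (sub_pos.2 hlt) (not_le.1 hX))

lemma mgf_scoreTerm_le (h0 : 0 < α) (h1 : α ≤ 1) (μ : ℝ) :
    mgf (scoreTerm α) (gaussianReal μ 1) (α / 2) ≤ Real.exp (1 / 2) := by
  calc mgf (scoreTerm α) (gaussianReal μ 1) (α / 2) ≤ ∫ _, Real.exp (1 / 2) ∂gaussianReal μ 1 := by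
        refine integral_mono (integrable_exp_mul_scoreTerm h0 h1 (by positivity) μ)
          (integrable_const _) fun x => Real.exp_le_exp.2 ?_
        calc α / 2 * scoreTerm α x ≤ α / 2 * (1 / α) := by
              gcongr
              exact scoreTerm_le h0 h1 x
          _ = 1 / 2 := by field_simp
    _ = Real.exp (1 / 2) := by simp

lemma dataLaw_real_scoreNonnegSet_le (θ : Fin n → ℝ) (h0 : 0 < α) (h1 : α ≤ 1 / 3) :
    (dataLaw θ).real (scoreNonnegSet n α) ≤ Real.exp ({i | θ i ≠ 0}.ncard / 2
      - (n - {i | θ i ≠ 0}.ncard) * (α / (960 * cutoff α))) := by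
  classical
  refine (measureReal_pi_le_exp_sum_sub (μ := fun i => gaussianReal (θ i) 1)
    (h := fun _ => scoreTerm α) (fun _ => by fun_prop) (t := α / 2) (by positivity)
    (fun i _ => integrable_exp_mul_scoreTerm h0 (by linarith) (by positivity) (θ i))
    (b := fun i => if θ i ≠ 0 then 1 / 2 else -(α / (960 * cutoff α)))
    (fun i _ => ?_) 0).trans_eq ?_
  · split_ifs with hi
    · exact mgf_scoreTerm_le h0 (by linarith) (θ i)
    · rw [not_not.1 hi]
      exact mgf_scoreTerm_half_le h0 h1
  · have hcard : {i | θ i ≠ 0}.ncard = (Finset.univ.filter fun i => θ i ≠ 0).card := by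
      rw [← Set.ncard_coe_finset]
      simp
    have hcompl : ((Finset.univ.filter fun i => ¬θ i ≠ 0).card : ℝ) =
        n - {i | θ i ≠ 0}.ncard := by
      rw [eq_sub_iff_add_eq', hcard]
      have := Finset.card_filter_add_card_filter_not (s := Finset.univ) (fun i => θ i ≠ 0)
      rw [Finset.card_univ, Fintype.card_fin] at this
      exact_mod_cast this
    rw [Finset.sum_ite, Finset.sum_const, Finset.sum_const, nsmul_eq_mul, nsmul_eq_mul, hcompl,
      ← hcard]
    ring_nf

end

section

variable {n s : ℝ}

/-- The order of magnitude `(s / n) √(log (n / s))` of the largest weight that the estimator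
selects when `s` of the `n` coordinates are nonzero, up to an event of small probability. -/
noncomputable def upperWeight (n s : ℝ) : ℝ := 3840 * (s / n) * √(Real.log (n / s))

lemma one_le_log_div (hs : 0 < s) (hsn : s ≤ 1 / 10 ^ 10 * n) : 1 ≤ Real.log (n / s) := by
  have hn : 0 < n := by linarith
  rw [Real.le_log_iff_exp_le (by positivity), le_div_iff₀ hs]
  nlinarith [Real.exp_one_lt_d9]

lemma one_le_sqrt_log_div (hs : 0 < s) (hsn : s ≤ 1 / 10 ^ 10 * n) : 1 ≤ √(Real.log (n / s)) :=
  Real.one_le_sqrt.2 (one_le_log_div hs hsn)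

lemma upperWeight_pos (hs : 0 < s) (hsn : s ≤ 1 / 10 ^ 10 * n) : 0 < upperWeight n s := by
  have hn : 0 < n := by linarith
  have hq := one_le_sqrt_log_div hs hsn
  unfold upperWeight
  positivity

lemma upperWeight_le (hs : 0 < s) (hsn : s ≤ 1 / 10 ^ 10 * n) : upperWeight n s ≤ 1 / 3 := by
  have hn : 0 < n := by linarith
  have hL := one_le_log_div hs hsn
  have hsq : (s / n * √(Real.log (n / s))) ^ 2 ≤ (1 / 10 ^ 5) ^ 2 := by
    rw [mul_pow, Real.sq_sqrt (by linarith)]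
    calc (s / n) ^ 2 * Real.log (n / s) ≤ (s / n) ^ 2 * (n / s) := by
          gcongr
          exact Real.log_le_self (by positivity)
      _ = s / n := by field_simp
      _ ≤ (1 / 10 ^ 5) ^ 2 := by
          rw [div_le_iff₀ hn]
          linarith
  have hle := le_of_sq_le_sq hsq (by norm_num)
  rw [upperWeight, mul_assoc]
  linarith

lemma cutoff_upperWeight_le (hs : 0 < s) (hsn : s ≤ 1 / 10 ^ 10 * n) :
    cutoff (upperWeight n s) ≤ 2 * √(Real.log (n / s)) := by
  have hn : 0 < n := by linarith
  have hA := upperWeight_pos hs hsn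
  have hq := one_le_sqrt_log_div hs hsn
  have hratio : 32 / upperWeight n s ≤ n / s := by
    rw [div_le_div_iff₀ hA hs, upperWeight]
    calc 32 * s ≤ 3840 * s * √(Real.log (n / s)) := by nlinarith
      _ = _ := by field_simp
  rw [cutoff, Real.sqrt_mul (by norm_num), show √(4 : ℝ) = 2 by
    rw [show (4 : ℝ) = 2 ^ 2 by norm_num, Real.sqrt_sq (by norm_num)]]
  gcongr

lemma mul_upperWeight_mul_cutoff_le (hs : 0 < s) (hsn : s ≤ 1 / 10 ^ 10 * n) :
    7 * upperWeight n s * cutoff (upperWeight n s) ≤ 53760 * (s * Real.log (n / s)) / n := by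
  have hL := one_le_log_div hs hsn
  have hA := upperWeight_pos hs hsn
  calc 7 * upperWeight n s * cutoff (upperWeight n s)
      ≤ 7 * upperWeight n s * (2 * √(Real.log (n / s))) := by
        gcongr
        exact cutoff_upperWeight_le hs hsn
    _ = 53760 * s / n * √(Real.log (n / s)) ^ 2 := by
        rw [upperWeight]
        ring
    _ = _ := by
        rw [Real.sq_sqrt (by linarith)]
        ring

lemma alphaMin_le_upperWeight {n : ℕ} (hlog : 1 ≤ Real.log n) (hlarge : 16 * Real.log n ≤ n)
    (hs : 4 * Real.log n ^ 2 ≤ s) (hsn : s ≤ 1 / 10 ^ 10 * n) : alphaMin n ≤ upperWeight n s := by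
  have hs0 : 0 < s := by nlinarith
  have hn : (0 : ℝ) < n := by linarith
  have hq := one_le_sqrt_log_div hs0 hsn
  calc alphaMin n ≤ 16 * Real.log n / n := alphaMin_le hlog hlarge
    _ ≤ 3840 * s / n := by
        gcongr ?_ / n
        nlinarith
    _ = 3840 * (s / n) * 1 := by ring
    _ ≤ upperWeight n s := by
        unfold upperWeight
        gcongr

lemma dataLaw_real_scoreNonnegSet_upperWeight_le {n : ℕ} (hlog : 1 ≤ Real.log n)
    (hs : 4 * Real.log n ^ 2 ≤ s) (hsn : s ≤ 1 / 10 ^ 10 * n) {θ : Fin n → ℝ}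
    (hθ : θ ∈ sparseVectors n s) :
    (dataLaw θ).real (scoreNonnegSet n (upperWeight n s)) ≤ 1 / n ^ 2 := by
  have hθ : ({i | θ i ≠ 0}.ncard : ℝ) ≤ s := hθ
  have hs0 : 0 < s := by nlinarith
  have hn : (0 : ℝ) < n := by linarith
  have hA := upperWeight_pos hs0 hsn
  have hA3 := upperWeight_le hs0 hsn
  have hζ := one_le_cutoff hA (by linarith)
  have hq := one_le_sqrt_log_div hs0 hsn
  have hdrift : s ≤ (n - {i | θ i ≠ 0}.ncard) *
      (upperWeight n s / (960 * cutoff (upperWeight n s))) := by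
    calc s = n / 2 * (upperWeight n s / (960 * (2 * √(Real.log (n / s))))) := by
          rw [upperWeight]
          field_simp
          norm_num
      _ ≤ n / 2 * (upperWeight n s / (960 * cutoff (upperWeight n s))) := by
          gcongr
          exact cutoff_upperWeight_le hs0 hsn
      _ ≤ _ := by
          gcongr
          linarith
  calc (dataLaw θ).real (scoreNonnegSet n (upperWeight n s))
      ≤ _ := dataLaw_real_scoreNonnegSet_le θ hA hA3
    _ ≤ Real.exp (-(2 * Real.log n)) := by
        gcongr
        nlinarith
    _ = 1 / n ^ 2 := by
        rw [Real.exp_neg, two_mul, Real.exp_add, Real.exp_log hn]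
        field_simp

end

/-! ### Sums of signal levels -/

section

variable {n s : ℝ}

lemma log_1024_mul_div_le {a : ℝ} (hn : 0 < n) (hs : 0 < s) (hsn : 1 ≤ Real.log (n / s))
    (ha : 0 < a) : Real.log (1024 * n / a) ≤ 8 * Real.log (n / s) + Real.log (s / a) := by
  have h1024 : Real.log 1024 ≤ 7 := by
    rw [show (1024 : ℝ) = 2 ^ 10 by norm_num, Real.log_pow]
    push_cast
    linarith [Real.log_two_lt_d9]
  rw [show 1024 * n / a = 1024 * (n / s) * (s / a) by field_simp,
    Real.log_mul (by positivity) (by positivity), Real.log_mul (by positivity) (by positivity)]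
  linarith

lemma mul_log_1024_mul_div_le {a : ℝ} (hn : 0 < n) (hsn : 1 ≤ Real.log (n / s)) (ha : 0 < a)
    (has : a ≤ s) : a * Real.log (1024 * n / a) ≤ 9 * (s * Real.log (n / s)) := by
  have hs : 0 < s := ha.trans_le has
  calc a * Real.log (1024 * n / a) ≤ a * (8 * Real.log (n / s) + Real.log (s / a)) := by
        gcongr
        exact log_1024_mul_div_le hn hs hsn ha
    _ = 8 * (a * Real.log (n / s)) + a * Real.log (s / a) := by ring
    _ ≤ 8 * (s * Real.log (n / s)) + s * Real.log (n / s) := by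
        gcongr ?_ + ?_
        · gcongr
        · exact (mul_log_div_le ha hs).trans (le_mul_of_one_le_right hs.le hsn)
    _ = _ := by ring

lemma sum_log_1024_mul_div_le (hn : 0 < n) (hs : 0 < s) (hsn : 1 ≤ Real.log (n / s)) {k m : ℕ}
    (hm : m ≤ s) :
    ∑ j ∈ Finset.Ioc k m, Real.log (1024 * n / j) ≤ 9 * (s * Real.log (n / s)) := by
  have hpos : ∀ j ∈ Finset.Icc 1 m, (0 : ℝ) < j := fun j hj => by
    exact_mod_cast (Finset.mem_Icc.1 hj).1
  have hjs : ∀ j ∈ Finset.Icc 1 m, (j : ℝ) ≤ s := fun j hj =>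
    (Nat.cast_le.2 (Finset.mem_Icc.1 hj).2).trans hm
  calc ∑ j ∈ Finset.Ioc k m, Real.log (1024 * n / j)
      ≤ ∑ j ∈ Finset.Ioc k m, (8 * Real.log (n / s) + Real.log (s / j)) :=
        Finset.sum_le_sum fun j hj => log_1024_mul_div_le hn hs hsn
          (by exact_mod_cast (Nat.zero_le k).trans_lt (Finset.mem_Ioc.1 hj).1)
    _ ≤ ∑ j ∈ Finset.Icc 1 m, (8 * Real.log (n / s) + Real.log (s / j)) := by
        refine Finset.sum_le_sum_of_subset_of_nonneg (fun j hj => ?_) fun j hj _ => ?_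
        · rw [Finset.mem_Ioc] at hj
          exact Finset.mem_Icc.2 ⟨by lia, hj.2⟩
        · linarith [Real.log_nonneg ((one_le_div (hpos j hj)).2 (hjs j hj))]
    _ = m * (8 * Real.log (n / s)) + ∑ j ∈ Finset.Icc 1 m, Real.log (s / j) := by
        rw [Finset.sum_add_distrib, Finset.sum_const, Nat.card_Icc, Nat.add_sub_cancel,
          nsmul_eq_mul]
    _ ≤ s * (8 * Real.log (n / s)) + s * Real.log (n / s) := by
        gcongr
        exact (sum_log_div_le hs m).trans (le_mul_of_one_le_right hs.le hsn)
    _ = _ := by ring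

end

/-! ### Risk at the null coordinates -/

section

variable {n : ℕ} {αhat : (Fin n → ℝ) → ℝ} {θ : Fin n → ℝ} {s : ℝ}

instance isProbabilityMeasure_dataLaw (θ : Fin n → ℝ) : IsProbabilityMeasure (dataLaw θ) := by
  unfold dataLaw
  infer_instance

lemma riskBound_zero_le {α : ℝ} (h0 : 0 ≤ α) (h1 : α ≤ 1) (x : ℝ) :
    riskBound α x 0 ≤ 32 * (postWeight α x * (1 + x ^ 2)) := by
  rw [riskBound]
  nlinarith [mul_nonneg (postWeight_nonneg h0 h1 x) (sq_nonneg x)]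

lemma riskBound_mle_zero_le (h : IsMarginalMLE αhat) (hn : 0 < n) {A : ℝ}
    (hA : A ∈ Set.Icc (alphaMin n) 1) (X : Fin n → ℝ) (x : ℝ) :
    riskBound (αhat X) x 0 ≤ 32 * (postWeight A x * (1 + x ^ 2))
      + (16 / n * (1 + x ^ 2) ^ 2 + (scoreNonnegSet n A).indicator (fun _ => (16 * n : ℝ)) X) := by
  have h0 : 0 ≤ αhat X := (alphaMin_pos n).le.trans (h X).1.1
  have h1 : αhat X ≤ 1 := (h X).1.2
  have hA0 : 0 ≤ A := (alphaMin_pos n).le.trans hA.1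
  refine (riskBound_zero_le h0 h1 x).trans ?_
  by_cases hX : X ∈ scoreNonnegSet n A
  · have hamgm : 32 * (1 + x ^ 2) ≤ 16 / n * (1 + x ^ 2) ^ 2 + 16 * n := by
      rw [← sub_nonneg]
      calc 0 ≤ 16 / n * (1 + x ^ 2 - n) ^ 2 := by positivity
        _ = _ := by
          field_simp
          ring
    rw [Set.indicator_of_mem hX]
    nlinarith [mul_le_of_le_one_left (by positivity : 0 ≤ 1 + x ^ 2) (postWeight_le_one h0 h1 x),
      mul_nonneg (postWeight_nonneg hA0 hA.2 x) (by positivity : 0 ≤ 1 + x ^ 2)]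
  · rw [Set.indicator_of_notMem hX, add_zero]
    refine le_add_of_le_of_nonneg ?_ (by positivity)
    gcongr
    exact postWeight_mono h0 (mle_le_of_notMem_scoreNonnegSet h hA hX) hA.2 x

lemma one_add_sq_sq (x : ℝ) : (1 + x ^ 2) ^ 2 = 1 + (2 * x ^ 2 + x ^ 4) := by ring

lemma integrable_one_add_sq_sq_gaussianReal (m : ℝ) :
    Integrable (fun x => (1 + x ^ 2) ^ 2) (gaussianReal m 1) := by
  simp only [one_add_sq_sq]
  exact (integrable_const 1).add (((integrable_pow_gaussianReal m 2).const_mul 2).add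
    (integrable_pow_gaussianReal m 4))

lemma integral_one_add_sq_sq_gaussianReal : ∫ x, (1 + x ^ 2) ^ 2 ∂gaussianReal 0 1 = 6 := by
  have h2 : ∫ x, x ^ 2 ∂gaussianReal 0 1 = 1 := by simpa using integral_sub_sq_gaussianReal 0
  have h4 : ∫ x, x ^ 4 ∂gaussianReal 0 1 = 3 := by simpa using integral_sub_pow_four_gaussianReal 0
  have hint2 := (integrable_pow_gaussianReal 0 2).const_mul 2
  have hint4 := integrable_pow_gaussianReal 0 4
  have hint : Integrable (fun x => 2 * x ^ 2 + x ^ 4) (gaussianReal 0 1) := hint2.add hint4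
  simp only [one_add_sq_sq]
  rw [integral_add (integrable_const 1) hint, integral_add hint2 hint4, integral_const_mul, h2, h4]
  norm_num

lemma upperIntegralLE_riskBound_mle_zero (h : IsMarginalMLE αhat) (hlog : 1 ≤ Real.log n)
    (hlarge : 16 * Real.log n ≤ n) (hs : 4 * Real.log n ^ 2 ≤ s) (hsn : s ≤ 1 / 10 ^ 10 * n)
    (hθ : θ ∈ sparseVectors n s) {i : Fin n} (hi : θ i = 0) :
    UpperIntegralLE (dataLaw θ) (fun X => riskBound (αhat X) (X i) (θ i))
      (2 * 10 ^ 6 * (s * Real.log (n / s)) / n) := by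
  have hs0 : 0 < s := by nlinarith
  have hn : (0 : ℝ) < n := by linarith
  have hL := one_le_log_div hs0 hsn
  have hA := upperWeight_pos hs0 hsn
  have hA3 := upperWeight_le hs0 hsn
  have hweight := upperIntegralLE_pi_eval (μ := fun i => gaussianReal (θ i) 1) (i := i)
    (c := 32 * (53760 * (s * Real.log (n / s)) / n))
    ((integrable_postWeight_mul_one_add_sq hA.le (by linarith) (θ i)).const_mul 32)
    (by
      rw [integral_const_mul, hi]
      exact mul_le_mul_of_nonneg_left
        ((integral_postWeight_mul_one_add_sq_le hA (by linarith)).trans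
          (mul_upperWeight_mul_cutoff_le hs0 hsn)) (by norm_num))
  have hfourth := upperIntegralLE_pi_eval (μ := fun i => gaussianReal (θ i) 1) (i := i)
    (f := fun x => 16 / n * (1 + x ^ 2) ^ 2) (c := 96 / n)
    ((integrable_one_add_sq_sq_gaussianReal (θ i)).const_mul (16 / n : ℝ))
    (by
      rw [integral_const_mul, hi, integral_one_add_sq_sq_gaussianReal]
      exact (by ring : _ = _).le)
  have hbad : UpperIntegralLE (dataLaw θ)
      ((scoreNonnegSet n (upperWeight n s)).indicator fun _ => (16 * n : ℝ)) (16 / n) := by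
    refine upperIntegralLE_indicator (measurableSet_scoreNonnegSet n _) ?_
    calc _ ≤ 1 / (n : ℝ) ^ 2 * (16 * n) := by
          gcongr
          exact dataLaw_real_scoreNonnegSet_upperWeight_le hlog hs hsn hθ
      _ = _ := by field_simp
  refine (hweight.add (hfourth.add hbad)).mono (fun X => ?_) ?_
  · rw [hi]
    exact riskBound_mle_zero_le h (by exact_mod_cast hn)
      ⟨alphaMin_le_upperWeight hlog hlarge hs hsn, by linarith⟩ X (X i)
  · have : 1 ≤ s * Real.log (n / s) := by nlinarith
    rw [← add_div, mul_div_assoc', ← add_div]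
    gcongr
    linarith

/-! ### Risk at the nonzero coordinates -/

lemma sum_riskBound_le {α : ℝ} (h0 : 0 < α) (h1 : α ≤ 1) (X : Fin n → ℝ)
    {I L : Finset (Fin n)} (hL : L ⊆ I) :
    ∑ i ∈ I, riskBound α (X i) (θ i) ≤ ∑ i ∈ I \ L, θ i ^ 2 + 8 * (L.card * Real.log (32 / α))
      + ∑ i ∈ I, (40 + 4 * (X i - θ i) ^ 2) := by
  have hsmall : ∀ i, riskBound α (X i) (θ i) ≤ θ i ^ 2 + (40 + 4 * (X i - θ i) ^ 2) := fun i => by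
    rw [riskBound]
    nlinarith [mul_nonneg (postWeight_nonneg h0.le h1 (X i)) (sq_nonneg (θ i)),
      mul_le_of_le_one_left (by positivity : 0 ≤ 32 + 2 * (X i - θ i) ^ 2)
        (postWeight_le_one h0.le h1 (X i)), sq_nonneg (X i - θ i)]
  have hlarge : ∀ i, riskBound α (X i) (θ i) ≤
      8 * Real.log (32 / α) + (40 + 4 * (X i - θ i) ^ 2) := fun i => by
    linarith [riskBound_le h0 h1 (X i) (θ i)]
  calc ∑ i ∈ I, riskBound α (X i) (θ i)
      ≤ ∑ i ∈ I \ L, (θ i ^ 2 + (40 + 4 * (X i - θ i) ^ 2))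
        + ∑ i ∈ L, (8 * Real.log (32 / α) + (40 + 4 * (X i - θ i) ^ 2)) := by
        rw [← Finset.sum_sdiff hL]
        gcongr with i _ i _
        exacts [hsmall i, hlarge i]
    _ = _ := by
        rw [Finset.sum_add_distrib, Finset.sum_add_distrib (s := L), Finset.sum_const,
          nsmul_eq_mul, ← Finset.sum_sdiff hL (f := fun i => 40 + 4 * (X i - θ i) ^ 2)]
        ring

lemma log_div_mle_le (h : IsMarginalMLE αhat) (hlog : 1 ≤ Real.log n) (X : Fin n → ℝ) :
    Real.log (32 / αhat X) ≤ 7 * Real.log n := by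
  have hn : 0 < n := Nat.pos_of_ne_zero fun hn => by norm_num [hn] at hlog
  have hn' : (0 : ℝ) < n := by exact_mod_cast hn
  have h224 : Real.log 224 ≤ 6 := by
    calc Real.log 224 ≤ Real.log (2 ^ 8) := Real.log_le_log (by norm_num) (by norm_num)
      _ ≤ 6 := by
        rw [Real.log_pow]
        push_cast
        linarith [Real.log_two_lt_d9]
  calc Real.log (32 / αhat X) ≤ Real.log (32 / (7 * n : ℝ)⁻¹) := by
        have hle := (inv_le_alphaMin hn).trans (h X).1.1
        have hpos : 0 < αhat X := (alphaMin_pos n).trans_le (h X).1.1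
        gcongr
    _ = Real.log 224 + Real.log n := by
        rw [← Real.log_mul (by norm_num) hn'.ne', div_inv_eq_mul, ← mul_assoc]
        norm_num
    _ ≤ 7 * Real.log n := by linarith

lemma card_mul_log_div_mle_le (h : IsMarginalMLE αhat) (hlog : 1 ≤ Real.log n) {K : Finset (Fin n)}
    (hK : 0 < K.card) (hKn : (K.card : ℝ) ≤ n)
    (hθ : ∀ i ∈ K, 16 * Real.log (1024 * n / K.card) < θ i ^ 2) (X : Fin n → ℝ) :
    K.card * Real.log (32 / αhat X) ≤ K.card * Real.log (1024 * n / K.card)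
      + (noisySet θ K (cutoff (K.card / (32 * n)))).indicator
          (fun _ => K.card * (7 * Real.log n)) X := by
  have hK0 : (0 : ℝ) < K.card := by exact_mod_cast hK
  have hn : (0 : ℝ) < n := hK0.trans_le hKn
  have h0 : 0 < (K.card : ℝ) / (32 * n) := by positivity
  have h1 : (K.card : ℝ) / (32 * n) ≤ 1 / 2 := by
    rw [div_le_iff₀ (by positivity)]
    linarith
  have hinv : 32 / ((K.card : ℝ) / (32 * n)) = 1024 * n / K.card := by
    field_simp
    norm_num
  by_cases hX : X ∈ noisySet θ K (cutoff (K.card / (32 * n)))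
  · have hlog0 : 0 ≤ Real.log (1024 * n / K.card) :=
      Real.log_nonneg ((one_le_div hK0).2 (by linarith))
    rw [Set.indicator_of_mem hX]
    refine le_add_of_nonneg_of_le (by positivity) ?_
    gcongr
    exact log_div_mle_le h hlog X
  · have hcutoff : ∀ i ∈ K, 2 * cutoff (K.card / (32 * n)) ≤ |θ i| := fun i hi => by
      refine le_of_sq_le_sq ?_ (abs_nonneg _)
      rw [sq_abs, mul_pow, cutoff_sq h0 (by linarith), hinv]
      linarith [hθ i hi]
    have hle : K.card / (32 * n) ≤ αhat X := le_mle_of_notMem_noisySet h h0 h1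
      (by
        rw [show 16 * ((K.card : ℝ) / (32 * n)) * n = K.card / 2 by
          field_simp
          norm_num]
        exact half_lt_self hK0) hcutoff hX
    have hmle := h0.trans_le hle
    rw [Set.indicator_of_notMem hX, add_zero, ← hinv]
    gcongr

lemma upperIntegralLE_card_mul_log_div_mle (h : IsMarginalMLE αhat) (hlog : 1 ≤ Real.log n)
    (hs : 4 * Real.log n ^ 2 ≤ s) (hsn : s ≤ 1 / 10 ^ 10 * n) {K : Finset (Fin n)}
    (hKs : K.card ≤ s) (hθ : ∀ i ∈ K, 16 * Real.log (1024 * n / K.card) < θ i ^ 2) :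
    UpperIntegralLE (dataLaw θ) (fun X => K.card * Real.log (32 / αhat X))
      (37 * (s * Real.log (n / s))) := by
  have hs0 : 0 < s := by nlinarith
  have hn : (0 : ℝ) < n := by linarith
  have hL := one_le_log_div hs0 hsn
  rcases K.card.eq_zero_or_pos with hK | hK
  · exact (upperIntegralLE_const 0).mono (fun X => by simp [hK]) (by positivity)
  have hK0 : (0 : ℝ) < K.card := by exact_mod_cast hK
  have h0 : 0 < (K.card : ℝ) / (32 * n) := by positivity
  have h1 : (K.card : ℝ) / (32 * n) ≤ 1 := by
    rw [div_le_iff₀ (by positivity)]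
    linarith
  have hnoisy : (dataLaw θ).real (noisySet θ K (cutoff (K.card / (32 * n)))) *
      (K.card * (7 * Real.log n)) ≤ 28 * Real.log n := by
    calc _ ≤ Real.exp (-(K.card / 4)) * (K.card * (7 * Real.log n)) := by
          gcongr
          refine dataLaw_real_noisySet_le θ K (Real.sqrt_nonneg _) ?_
          linarith [cutoff_sq h0 h1, two_le_log_div h0 h1]
      _ = K.card * Real.exp (-(K.card / 4)) * (7 * Real.log n) := by ring
      _ ≤ 4 * (7 * Real.log n) := by
          gcongr
          exact mul_exp_neg_div_le (by norm_num) _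
      _ = 28 * Real.log n := by ring
  refine ((upperIntegralLE_const _).add
    (upperIntegralLE_indicator (measurableSet_noisySet θ K _) hnoisy)).mono
    (card_mul_log_div_mle_le h hlog hK (by linarith) hθ) ?_
  nlinarith [mul_log_1024_mul_div_le hn hL hK0 hKs]

lemma upperIntegralLE_sum_riskBound_mle (h : IsMarginalMLE αhat) (hlog : 1 ≤ Real.log n)
    (hs : 4 * Real.log n ^ 2 ≤ s) (hsn : s ≤ 1 / 10 ^ 10 * n) {I : Finset (Fin n)}
    (hI : I.card ≤ s) :
    UpperIntegralLE (dataLaw θ) (fun X => ∑ i ∈ I, riskBound (αhat X) (X i) (θ i))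
      (484 * (s * Real.log (n / s))) := by
  have hs0 : 0 < s := by nlinarith
  have hn : (0 : ℝ) < n := by linarith
  have hL := one_le_log_div hs0 hsn
  obtain ⟨K, hKI, hK, L, hLI, hLK, hsum⟩ :=
    exists_large_subset (fun i => θ i ^ 2) (fun j => 16 * Real.log (1024 * n / j)) I
  have hKs : K.card ≤ s := (Nat.cast_le.2 (Finset.card_le_card hKI)).trans hI
  have hrest : ∑ i ∈ I \ L, θ i ^ 2 ≤ 144 * (s * Real.log (n / s)) := by
    rw [← Finset.mul_sum] at hsum
    linarith [sum_log_1024_mul_div_le (k := K.card) hn hs0 hL hI]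
  have hnoise : UpperIntegralLE (dataLaw θ) (fun X => ∑ i ∈ I, (40 + 4 * (X i - θ i) ^ 2))
      (∑ _ ∈ I, 44) := .sum fun i _ => by
    have hint := (integrable_sub_pow_gaussianReal (θ i) (θ i) 2).const_mul 4
    refine upperIntegralLE_pi_eval (μ := fun i => gaussianReal (θ i) 1) (i := i)
      (f := fun x => 40 + 4 * (x - θ i) ^ 2) ((integrable_const 40).add hint) ?_
    rw [integral_add (integrable_const 40) hint, integral_const_mul, integral_sub_sq_gaussianReal]
    norm_num
  have hlarge := (upperIntegralLE_card_mul_log_div_mle h hlog hs hsn hKs hK).const_mul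
    (by norm_num : (0 : ℝ) ≤ 8)
  refine (((upperIntegralLE_const (144 * (s * Real.log (n / s)))).add hlarge).add hnoise).mono
    (fun X => ?_) ?_
  · have h0 : 0 < αhat X := (alphaMin_pos n).trans_le (h X).1.1
    have hlog0 := two_le_log_div h0 (h X).1.2
    refine (sum_riskBound_le h0 (h X).1.2 X hLI).trans ?_
    gcongr
  · rw [Finset.sum_const, nsmul_eq_mul]
    nlinarith

/-! ### Risk of the plug-in posterior -/

lemma postRisk_le (h : IsMarginalMLE αhat) (hlog : 1 ≤ Real.log n)
    (hlarge : 16 * Real.log n ≤ n) (hs : 4 * Real.log n ^ 2 ≤ s) (hsn : s ≤ 1 / 10 ^ 10 * n)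
    (hθ : θ ∈ sparseVectors n s) :
    postRisk αhat θ ≤ ENNReal.ofReal (10 ^ 7 * rate n s) := by
  have hs0 : 0 < s := by nlinarith
  have hn : (0 : ℝ) < n := by linarith
  have hL := one_le_log_div hs0 hsn
  set I : Finset (Fin n) := {i | θ i ≠ 0}
  have hI : (I.card : ℝ) ≤ s := by
    rw [← Set.ncard_coe_finset, Finset.coe_filter_univ]
    exact hθ
  have hnull : UpperIntegralLE (dataLaw θ) (fun X => ∑ i ∈ Iᶜ, riskBound (αhat X) (X i) (θ i))
      (2 * 10 ^ 6 * (s * Real.log (n / s))) := by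
    refine (UpperIntegralLE.sum fun i hi => upperIntegralLE_riskBound_mle_zero h hlog hlarge hs hsn
      hθ (by simpa [I] using hi)).mono (fun X => le_rfl) ?_
    rw [Finset.sum_const, nsmul_eq_mul, mul_div_assoc', div_le_iff₀ hn, mul_comm]
    gcongr
    simpa using Finset.card_le_univ Iᶜ
  have hsignal := upperIntegralLE_sum_riskBound_mle (θ := θ) h hlog hs hsn hI
  have hα : ∀ X, 0 ≤ αhat X := fun X => (alphaMin_pos n).le.trans (h X).1.1
  calc postRisk αhat θ
      ≤ ∫⁻ X, ENNReal.ofReal (∑ i, riskBound (αhat X) (X i) (θ i)) ∂dataLaw θ :=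
        lintegral_mono fun X => lintegral_posterior_le (hα X) (h X).1.2 X θ
    _ ≤ ENNReal.ofReal (10 ^ 7 * rate n s) := by
        refine UpperIntegralLE.lintegral_le
          ((hsignal.add hnull).mono (fun X => (Finset.sum_add_sum_compl I _).ge) ?_)
          fun X => Finset.sum_nonneg fun i _ => riskBound_nonneg (hα X) (h X).1.2 _ _
        rw [rate]
        nlinarith

lemma rate_nonneg (hs : 0 ≤ s) (hsn : s ≤ n) : 0 ≤ rate n s := by
  rcases hs.eq_or_lt with rfl | hs
  · simp [rate]
  · exact mul_nonneg (by positivity) (Real.log_nonneg ((one_le_div hs).2 hsn))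

lemma rate_four_mul_log_sq_le (hlog : 1 ≤ Real.log n) :
    rate n (4 * Real.log n ^ 2) ≤ 8 * Real.log n ^ 3 := by
  have hn : (0 : ℝ) < n := Nat.cast_pos.2 (Nat.pos_of_ne_zero fun hn => by norm_num [hn] at hlog)
  calc rate n (4 * Real.log n ^ 2)
      ≤ 2 * (4 * Real.log n ^ 2) * Real.log n := by
        rw [rate]
        gcongr
        exact div_le_self hn.le (by nlinarith)
    _ = 8 * Real.log n ^ 3 := by ring

lemma postRisk_le_add (h : IsMarginalMLE αhat) (hlog : 1 ≤ Real.log n)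
    (hlarge : 16 * Real.log n ≤ n) (hlogsq : 4 * Real.log n ^ 2 ≤ 1 / 10 ^ 10 * n) (hs : 0 ≤ s)
    (hsn : s ≤ 1 / 10 ^ 10 * n) (hθ : θ ∈ sparseVectors n s) :
    postRisk αhat θ ≤ ENNReal.ofReal (10 ^ 8 * rate n s + 10 ^ 8 * Real.log n ^ 3) := by
  have hrate := rate_nonneg hs (by linarith)
  have hlog3 : 0 ≤ Real.log n ^ 3 := by positivity
  rcases le_total (4 * Real.log n ^ 2) s with hle | hle
  · exact (postRisk_le h hlog hlarge hle hsn hθ).trans (ENNReal.ofReal_le_ofReal (by linarith))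
  · exact (postRisk_le h hlog hlarge le_rfl hlogsq (hθ.trans hle)).trans
      (ENNReal.ofReal_le_ofReal (by linarith [rate_four_mul_log_sq_le hlog]))

end

lemma eventually_log_bounds : ∀ᶠ n : ℕ in Filter.atTop, 1 ≤ Real.log n ∧
    16 * Real.log n ≤ n ∧ 4 * Real.log n ^ 2 ≤ 1 / 10 ^ 10 * n := by
  have hone : ∀ᶠ n : ℕ in Filter.atTop, 1 ≤ Real.log n :=
    (Real.tendsto_log_atTop.comp tendsto_natCast_atTop_atTop).eventually_ge_atTop 1
  have hsq := ((Real.isLittleO_pow_log_id_atTop (n := 2)).comp_tendsto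
    tendsto_natCast_atTop_atTop).bound (by norm_num : (0 : ℝ) < 1 / 10 ^ 12)
  filter_upwards [hone, hsq] with n hlog hle
  have hle : Real.log n ^ 2 ≤ 1 / 10 ^ 12 * n := by simpa using hle
  exact ⟨hlog, by nlinarith, by linarith⟩

end SpikeSlab

theorem theorem3 :
    ∃ (C c₀ c₁ : ℝ) (N₀ : ℕ), 0 < C ∧ 0 < c₀ ∧ 0 < c₁ ∧ 0 < N₀ ∧
      ∀ n : ℕ, N₀ ≤ n →
        ∀ αhat : (Fin n → ℝ) → ℝ, SpikeSlab.IsMarginalMLE αhat →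
          ∀ s : ℝ, 0 ≤ s → s ≤ c₀ * n →
            (c₁ * Real.log n ^ 2 ≤ s →
              (⨆ θ₀ ∈ SpikeSlab.sparseVectors n s, SpikeSlab.postRisk αhat θ₀)
                ≤ ENNReal.ofReal (C * SpikeSlab.rate n s)) ∧
            (⨆ θ₀ ∈ SpikeSlab.sparseVectors n s, SpikeSlab.postRisk αhat θ₀)
              ≤ ENNReal.ofReal (C * SpikeSlab.rate n s + C * Real.log n ^ 3) := by
  obtain ⟨N, hN⟩ := Filter.eventually_atTop.1 SpikeSlab.eventually_log_bounds
  refine ⟨10 ^ 8, 1 / 10 ^ 10, 4, N + 1, by norm_num, by norm_num, by norm_num, N.succ_pos,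
    fun n hn αhat h s hs0 hsn => ?_⟩
  obtain ⟨hlog, hlarge, hlogsq⟩ := hN n (by lia)
  refine ⟨fun hs => iSup₂_le fun θ hθ => ?_, iSup₂_le fun θ hθ =>
    SpikeSlab.postRisk_le_add h hlog hlarge hlogsq hs0 hsn hθ⟩
  have hrate := SpikeSlab.rate_nonneg hs0 (by linarith)
  exact (SpikeSlab.postRisk_le h hlog hlarge hs hsn hθ).trans
    (ENNReal.ofReal_le_ofReal (by linarith))
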